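/- Let $p$ be a prime, let $Z=\operatorname{Spec} O_Z$ be a flat affine group scheme of finite type over $\mathbb{Z}_p$, and let $\mathcal{P}=\operatorname{Spec} O_{\mathcal{P}}$ be a $Z$-torsor. Let $D$ be a $p$-divisible group over a scheme $S$, let $\underline{\mathrm{Aut}}(D)$ be the functor $A\mapsto ((\mathrm{End}_S D)\otimes_{\mathbb{Z}_p}A)^\times$ on $\mathbb{Z}_p$-algebras, and let $Z\to\underline{\mathrm{Aut}}(D)$ be a homomorphism of group functors. For $n\ge 0$ and an $S$-scheme $T$ put $$D^{\mathcal{P}}[p^n](T)=(D[p^n](T)\otimes_{\mathbb{Z}_p}O_{\mathcal{P}})^Z .$$ (1) The presheaf $D^{\mathcal{P}}[p^n]$ is represented, for $n\ge 1$, by a truncated $p$-divisible group of level $n$ over $S$, and the direct system $D^{\mathcal{P}}=(D^{\mathcal{P}}[p^n])_n$ is a $p$-divisible group over $S$. (2) Assume moreover that $S$ is integral and flat over $\mathbb{Z}_{(p)}$ and that $Z$ is smooth with connected fibers. Let $T_p(D)$ be the $p$-adic Tate module of $D$ at a geometric generic point of $S$, and for a $\mathbb{Z}_p$-module $M$ let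 $M^\otimes=\bigoplus_{a,b\ge 0}M^{\otimes a}\otimes (M^\vee)^{\otimes b}$. Then there is a canonical isomorphism $T_p(D^{\mathcal{P}})\cong (T_p(D)\otimes_{\mathbb{Z}_p}O_{\mathcal{P}})^Z$, namely the unique one that lifts the identifications $D^{\mathcal{P}}[p^n](T)=(D[p^n](T)\otimes_{\mathbb{Z}_p} O_{\mathcal{P}})^Z$ for $T$ the geometric generic point, and it extends to an isomorphism $T_p(D^{\mathcal{P}})\otimes O_{\mathcal{P}}\cong T_p(D)\otimes O_{\mathcal{P}}$. Let $t\in T_p(D)^\otimes$ be $Z$-invariant. Then there is a unique $t'\in T_p(D^{\mathcal{P}})^\otimes$ that becomes equal to $t$ under the latter isomorphism, and there is an isomorphism $D^{\mathcal{P}}\cong D$ of $p$-divisible groups over $S$ mapping $t'$ to $t$. -/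

import Mathlib

open CategoryTheory AlgebraicGeometry TensorProduct WithConv
open scoped MonObj

universe u v w

set_option linter.unusedSectionVars false

noncomputable section

namespace KisinTwist

/-! ### Affine group schemes, torsors, and twisting of modules

An affine group scheme `Z` over `R` is given by its commutative Hopf algebra `H = O_Z`;
its group of points in an `R`-algebra `A` is `WithConv (H →ₐ[R] A)` (convolution product). -/

section Algebra

variable {R : Type w} [CommRing R]

/-- A (right) torsor `P = Spec B` under `Z = Spec H`: a faithfully flat `R`-scheme with an action
`P × Z → P` (the coaction `coact`) such that `P × Z → P × P`, `(y, z) ↦ (y, y z)`, is an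
isomorphism. -/
structure Torsor (R : Type w) [CommRing R] (H B : Type v) [CommRing H] [HopfAlgebra R H]
    [CommRing B] [Algebra R B] where
  coact : B →ₐ[R] B ⊗[R] H
  coact_counit : (Algebra.TensorProduct.rid R R B).toAlgHom.comp
    ((Algebra.TensorProduct.map (AlgHom.id R B) (Bialgebra.counitAlgHom R H)).comp coact) =
      AlgHom.id R B
  coact_coassoc : (Algebra.TensorProduct.assoc R R R B H H).toAlgHom.comp
    ((Algebra.TensorProduct.map coact (AlgHom.id R H)).comp coact) =
      (Algebra.TensorProduct.map (AlgHom.id R B) (Bialgebra.comulAlgHom R H)).comp coact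
  faithfullyFlat : Module.FaithfullyFlat R B
  bijective : Function.Bijective (Algebra.TensorProduct.lift
    (Algebra.TensorProduct.includeLeft : B →ₐ[R] B ⊗[R] H) coact (fun _ _ => Commute.all _ _))

variable {H B : Type v} [CommRing H] [HopfAlgebra R H] [CommRing B] [Algebra R B]

/-- The action `P(A) × Z(A) → P(A)`, `(y, z) ↦ y z`. -/
def Torsor.smul (P : Torsor R H B) {A : Type v} [CommRing A] [Algebra R A]
    (y : B →ₐ[R] A) (z : WithConv (H →ₐ[R] A)) : B →ₐ[R] A :=
  (Algebra.TensorProduct.lift y z.ofConv (fun _ _ => Commute.all _ _)).comp P.coact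

/-- For a (noncommutative) `R`-algebra `E`, a homomorphism of `R`-groups from `Z` to the `R`-group
`A ↦ (A ⊗ E)ˣ`. -/
structure GroupHom (R : Type w) [CommRing R] (H : Type v) [CommRing H] [HopfAlgebra R H]
    (E : Type u) [Ring E] [Algebra R E] where
  app : ∀ (A : Type v) [CommRing A] [Algebra R A], WithConv (H →ₐ[R] A) →* (A ⊗[R] E)ˣ
  naturality : ∀ (A A' : Type v) [CommRing A] [Algebra R A] [CommRing A'] [Algebra R A']
    (f : A →ₐ[R] A') (z : WithConv (H →ₐ[R] A)),
    (app A' (toConv (f.comp z.ofConv)) : A' ⊗[R] E) =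
      Algebra.TensorProduct.map f (AlgHom.id R E) (app A z : A ⊗[R] E)

variable {E : Type u} [Ring E] [Algebra R E] {M : Type*} [AddCommGroup M] [Module R M]

/-- If `E` acts on `M` through `θ`, then `Z(A)` acts on `A ⊗ M` by `A`-linear automorphisms. -/
def GroupHom.act (ρ : GroupHom R H E) (θ : E →ₐ[R] Module.End R M)
    {A : Type v} [CommRing A] [Algebra R A] (z : WithConv (H →ₐ[R] A)) :
    (A ⊗[R] M) ≃ₗ[A] (A ⊗[R] M) :=
  LinearMap.GeneralLinearGroup.toLinearEquiv
    (Units.map (((LinearMap.tensorProductEnd R A M).comp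
      (Algebra.TensorProduct.map (AlgHom.id A A) θ)) :
        (A ⊗[R] E) →* Module.End A (A ⊗[R] M)) (ρ.app A z))

/-- The value `x(y) ∈ A ⊗ M` of `x ∈ O_P ⊗ M` (a function on `P` with values in `M`) at a point
`y ∈ P(A)`. -/
def evalAt (M : Type*) [AddCommGroup M] [Module R M] {A : Type v} [CommRing A] [Algebra R A]
    (y : B →ₐ[R] A) : B ⊗[R] M →ₗ[R] A ⊗[R] M :=
  LinearMap.rTensor M y.toLinearMap

/-- The twist `M^P = (M ⊗ O_P)^Z`. Here `z ∈ Z` sends a function `x` on `P` with values in `M`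
to the function `y ↦ z • x(y z)` (diagonal action), and invariance is required for the points of
`Z` in all `R`-algebras. -/
def twist (ρ : GroupHom R H E) (P : Torsor R H B) (θ : E →ₐ[R] Module.End R M) :
    Submodule R (B ⊗[R] M) where
  carrier := {x | ∀ (A : Type v) [CommRing A] [Algebra R A] (y : B →ₐ[R] A)
    (z : WithConv (H →ₐ[R] A)), ρ.act θ z (evalAt M (P.smul y z) x) = evalAt M y x}
  zero_mem' := fun A _ _ y z => by simp only [map_zero]
  add_mem' := fun {a b} ha hb A _ _ y z => by
    simp only [map_add, ha A y z, hb A y z]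
  smul_mem' := fun c x hx A _ _ y z => by
    rw [LinearMap.map_smul, LinearMap.map_smul, ← hx A y z]
    exact LinearMap.map_smul ((ρ.act θ z).toLinearMap.restrictScalars R) c _

end Algebra

/-! ### The tensor space `M^⊗` -/

section Tensor

/-- `M^{⊗a} ⊗ (M^∨)^{⊗b}`. -/
abbrev Mixed (A : Type*) [CommRing A] (N : Type*) [AddCommGroup N] [Module A N] (i : ℕ × ℕ) :=
  (⨂[A] _ : Fin i.1, N) ⊗[A] (⨂[A] _ : Fin i.2, Module.Dual A N)

/-- `N^⊗`, the direct sum of all `N^{⊗a} ⊗ (N^∨)^{⊗b}`. -/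
abbrev TensorSpace (A : Type*) [CommRing A] (N : Type*) [AddCommGroup N] [Module A N] :=
  DirectSum (ℕ × ℕ) (Mixed A N)

/-- Transport of tensors along an isomorphism. -/
def TensorSpace.map {A : Type*} [CommRing A] {N N' : Type*} [AddCommGroup N] [Module A N]
    [AddCommGroup N'] [Module A N'] (g : N ≃ₗ[A] N') : TensorSpace A N →ₗ[A] TensorSpace A N' :=
  DirectSum.lmap fun _ => TensorProduct.map
    (PiTensorProduct.map fun _ => g.toLinearMap)
    (PiTensorProduct.map fun _ => g.symm.toLinearMap.dualMap)

variable (R : Type*) [CommRing R] (A : Type*) [CommRing A] [Algebra R A]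
  (M : Type*) [AddCommGroup M] [Module R M]

/-- `L^{⊗n} → N^{⊗n}` (over `R` and `A` respectively) induced by an `R`-linear map from `L` to an
`A`-module `N`. -/
def powExt {L N : Type*} [AddCommGroup L] [Module R L] [AddCommGroup N] [Module R N] [Module A N]
    [IsScalarTower R A N] (f : L →ₗ[R] N) (n : ℕ) :
    (⨂[R] _ : Fin n, L) →ₗ[R] (⨂[A] _ : Fin n, N) :=
  PiTensorProduct.lift
    (((PiTensorProduct.tprod A (s := fun _ : Fin n => N)).restrictScalars R).compLinearMap
      fun _ => f)

/-- Extension of scalars `M^⊗ → (A ⊗ M)^⊗`, `t ↦ 1 ⊗ t`. -/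
def TensorSpace.ext : TensorSpace R M →+ TensorSpace A (A ⊗[R] M) :=
  DirectSum.map fun i => (TensorProduct.lift
    (((TensorProduct.mk A (⨂[A] _ : Fin i.1, A ⊗[R] M)
      (⨂[A] _ : Fin i.2, Module.Dual A (A ⊗[R] M))).restrictScalars₁₂ R R).compl₁₂
        (powExt R A (TensorProduct.mk R A M 1) i.1)
        (powExt R A (Module.Dual.baseChange A) i.2))).toAddMonoidHom

end Tensor

/-! ### `p`-divisible groups -/

section CommGrp

variable {C : Type u} [Category.{v} C] [CartesianMonoidalCategory C] [BraidedCategory C]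

/-- Homomorphisms of commutative group objects form an abelian group. -/
def commGrpHomEquiv (G G' : CommGrp C) : (G ⟶ G') ≃ Additive (G.toGrp ⟶ G'.toGrp) where
  toFun f := Additive.ofMul f.hom
  invFun f := InducedCategory.homMk f.toMul
  left_inv _ := rfl
  right_inv _ := rfl

instance (G G' : CommGrp C) : AddCommGroup (G ⟶ G') := (commGrpHomEquiv G G').addCommGroup

lemma commGrp_add_hom {G G' : CommGrp C} (f g : G ⟶ G') :
    (f + g).hom.hom.hom = f.hom.hom.hom * g.hom.hom.hom := rfl

instance : Preadditive (CommGrp C) where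
  add_comp G G' G'' f f' g := by
    ext
    exact MonObj.mul_comp _ _ _
  comp_add G G' G'' f g g' := by
    ext
    exact MonObj.comp_mul _ _ _

lemma commGrp_nsmul_hom {G G' : CommGrp C} (f : G ⟶ G') (n : ℕ) :
    (n • f).hom.hom.hom = f.hom.hom.hom ^ n := by
  induction n with
  | zero => rw [zero_smul, pow_zero]; rfl
  | succ n ih => rw [succ_nsmul, commGrp_add_hom, ih, pow_succ]

end CommGrp

variable (p : ℕ) [Fact p.Prime]

/-- A `p`-divisible group over `S`, given by its levels `G n = D[p^n]` and the inclusions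
`G n → G (n + 1)`: the `G n` are finite locally free commutative group schemes, `G n` is the
`p^n`-torsion of `G (n + 1)`, and multiplication by `p` is an epimorphism of fppf sheaves on
`D = colim G n`, i.e. every section of `G n` is fppf-locally `p` times a section of `G (n + 1)`.
(The groups `T ⟶ G n` are written multiplicatively.) -/
structure PDivGroup (S : Scheme.{u}) where
  G : ℕ ⥤ CommGrp (Over S)
  finite : ∀ n, IsFinite (G.obj n).X.hom
  flat : ∀ n, Flat (G.obj n).X.hom
  locallyOfFinitePresentation : ∀ n, LocallyOfFinitePresentation (G.obj n).X.hom
  incl_injective : ∀ (n : ℕ) (T : Over S), Function.Injective fun x : T ⟶ (G.obj n).X =>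
    x ≫ (G.map (homOfLE n.le_succ)).hom.hom.hom
  torsion : ∀ (n : ℕ) (T : Over S) (y : T ⟶ (G.obj (n + 1)).X), y ^ p ^ n = 1 ↔
    ∃ x : T ⟶ (G.obj n).X, x ≫ (G.map (homOfLE n.le_succ)).hom.hom.hom = y
  divisible : ∀ (n : ℕ) (T : Over S) (x : T ⟶ (G.obj n).X), ∃ (T' : Over S) (f : T' ⟶ T),
    Flat f.left ∧ Surjective f.left ∧ LocallyOfFinitePresentation f.left ∧
      ∃ y : T' ⟶ (G.obj (n + 1)).X,
        y ^ p = f ≫ x ≫ (G.map (homOfLE n.le_succ)).hom.hom.hom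

/-- `G` is a truncated `p`-divisible group of level `n`, in the strongest sense: it is isomorphic
to the `p^n`-torsion of a `p`-divisible group over all of `S`. -/
def IsTruncatedPDiv {S : Scheme.{u}} (n : ℕ) (G : CommGrp (Over S)) : Prop :=
  ∃ D : PDivGroup p S, Nonempty (G ≅ D.G.obj n)

namespace PDivGroup

variable {p} {S : Scheme.{u}} (D D' : PDivGroup p S)

/-- The endomorphism ring `End_S D`. -/
abbrev EndRing := End D.G

/-- The group `D[p^n](T)`, written additively. -/
def Pts (n : ℕ) (T : Over S) : Type u := Additive (T ⟶ (D.G.obj n).X)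

variable {D} in
/-- A section of `D[p^n]` as an element of `D[p^n](T)`. -/
def toPts {n : ℕ} {T : Over S} (x : T ⟶ (D.G.obj n).X) : D.Pts n T := Additive.ofMul x

variable {D} in
/-- The section of `D[p^n]` underlying an element of `D[p^n](T)`. -/
def Pts.hom {n : ℕ} {T : Over S} (x : D.Pts n T) : T ⟶ (D.G.obj n).X := Additive.toMul x

instance (n : ℕ) (T : Over S) : AddCommGroup (D.Pts n T) :=
  inferInstanceAs (AddCommGroup (Additive (T ⟶ (D.G.obj n).X)))

lemma hom_pow_eq_one {n : ℕ} {T : Over S} (x : T ⟶ (D.G.obj n).X) : x ^ p ^ n = 1 := by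
  apply D.incl_injective n T
  have h := (D.torsion n T _).2 ⟨x, rfl⟩
  simp only [MonObj.pow_comp, MonObj.one_comp]
  exact h

lemma pow_nsmul_eq_zero {n : ℕ} {T : Over S} (x : D.Pts n T) : p ^ n • x = 0 :=
  D.hom_pow_eq_one x.hom

lemma pow_nsmul_id (n : ℕ) : p ^ n • 𝟙 (D.G.obj n) = 0 := by
  ext1
  rw [commGrp_nsmul_hom]
  exact D.hom_pow_eq_one _

/-- Multiplication by a natural number on a group killed by `p^n` depends only on its class
modulo `p^n`. -/
lemma nsmul_congr {A : Type*} [AddCommGroup A] {n : ℕ} {x : A} (hx : p ^ n • x = 0) {a b : ℕ}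
    (h : (a : ZMod (p ^ n)) = b) : a • x = b • x := by
  have h1 : addOrderOf x ∣ p ^ n := addOrderOf_dvd_of_nsmul_eq_zero hx
  rw [nsmul_eq_nsmul_iff_modEq]
  exact ((ZMod.natCast_eq_natCast_iff _ _ _).1 h).of_dvd h1

/-- `z mod p^n`, as a natural number. -/
abbrev residue (z : ℤ_[p]) (n : ℕ) : ℕ := (PadicInt.toZModPow n z).val

lemma residue_cast (z : ℤ_[p]) (n : ℕ) : (residue z n : ZMod (p ^ n)) = PadicInt.toZModPow n z :=
  ZMod.natCast_zmod_val _

lemma residue_cast_of_le (z : ℤ_[p]) {m n : ℕ} (h : m ≤ n) :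
    (residue z n : ZMod (p ^ m)) = residue z m := by
  rw [residue_cast, ← PadicInt.cast_toZModPow m n h, ZMod.natCast_val]

/-- `ℤ_p` acts on `D[p^n](T)` through `ℤ/p^n`. -/
instance (n : ℕ) (T : Over S) : Module ℤ_[p] (D.Pts n T) where
  smul z x := residue z n • x
  one_smul x := (nsmul_congr (D.pow_nsmul_eq_zero x) (b := 1)
    (by rw [residue_cast]; simp)).trans (one_smul _ _)
  mul_smul a b x := (nsmul_congr (D.pow_nsmul_eq_zero x) (b := residue a n * residue b n)
    (by simp only [Nat.cast_mul, residue_cast, map_mul])).trans (mul_smul _ _ _)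
  smul_zero z := smul_zero (residue z n)
  smul_add z := smul_add (residue z n)
  add_smul a b x := (nsmul_congr (D.pow_nsmul_eq_zero x) (b := residue a n + residue b n)
    (by simp only [Nat.cast_add, residue_cast, map_add])).trans (add_smul _ _ _)
  zero_smul x := (nsmul_congr (D.pow_nsmul_eq_zero x) (b := 0)
    (by rw [residue_cast]; simp)).trans (zero_smul _ _)

lemma padic_smul_def {n : ℕ} {T : Over S} (z : ℤ_[p]) (x : D.Pts n T) :
    z • x = residue z n • x := rfl

/-- An additive map between groups of points of level at most `n`, `m`, with `n ≤ m`, is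
`ℤ_p`-linear. -/
def linearOfAdd {D D' : PDivGroup p S} {n m : ℕ} (h : n ≤ m) {T T' : Over S}
    (f : D.Pts n T →+ D'.Pts m T') : D.Pts n T →ₗ[ℤ_[p]] D'.Pts m T' where
  toFun := f
  map_add' := f.map_add
  map_smul' z x := by
    simp only [padic_smul_def, map_nsmul, RingHom.id_apply]
    exact (nsmul_congr (n := n) (by rw [← map_nsmul, D.pow_nsmul_eq_zero, map_zero])
      (residue_cast_of_le z h)).symm

/-- Restriction `D[p^n](T) → D[p^n](T')` along `T' → T`. -/
def res (n : ℕ) {T T' : Over S} (f : T' ⟶ T) : D.Pts n T →ₗ[ℤ_[p]] D.Pts n T' :=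
  linearOfAdd le_rfl
    { toFun := fun x => toPts (f ≫ x.hom)
      map_zero' := MonObj.comp_one f
      map_add' := fun x y => MonObj.comp_mul f x.hom y.hom }

/-- The map on sections induced by a homomorphism from `D[p^n]` to `D'[p^m]`, `n ≤ m`. -/
def ptsMap {D D' : PDivGroup p S} {n m : ℕ} (h : n ≤ m) (f : D.G.obj n ⟶ D'.G.obj m)
    (T : Over S) : D.Pts n T →ₗ[ℤ_[p]] D'.Pts m T :=
  linearOfAdd h
    { toFun := fun x => toPts (x.hom ≫ f.hom.hom.hom)
      map_zero' := MonObj.one_comp f.hom.hom.hom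
      map_add' := fun x y => MonObj.mul_comp x.hom y.hom f.hom.hom.hom }

/-- The inclusion `D[p^n](T) → D[p^(n+1)](T)`. -/
def incl (n : ℕ) (T : Over S) : D.Pts n T →ₗ[ℤ_[p]] D.Pts (n + 1) T :=
  ptsMap n.le_succ (D.G.map (homOfLE n.le_succ)) T

/-- Multiplication by a `p`-adic integer on `D`. -/
def padicEnd (z : ℤ_[p]) : D.EndRing where
  app n := residue z n • 𝟙 (D.G.obj n)
  naturality n m f := by
    have h : n ≤ m := leOfHom f
    simp only [Preadditive.comp_nsmul, Preadditive.nsmul_comp, Category.id_comp, Category.comp_id]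
    refine nsmul_congr (n := n) ?_ (residue_cast_of_le z h)
    rw [← Category.id_comp (D.G.map f), ← Preadditive.nsmul_comp, D.pow_nsmul_id,
      Limits.zero_comp]

lemma padicEnd_congr {z : ℤ_[p]} {n a : ℕ} (h : (a : ZMod (p ^ n)) = PadicInt.toZModPow n z) :
    (D.padicEnd z).app n = a • 𝟙 (D.G.obj n) :=
  nsmul_congr (D.pow_nsmul_id n) (by rw [residue_cast, h])

/-- `ℤ_p` acts on `D`. -/
def padicEndHom : ℤ_[p] →+* D.EndRing where
  toFun := D.padicEnd
  map_one' := by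
    refine NatTrans.ext (funext fun n => ?_)
    rw [D.padicEnd_congr (a := 1) (by simp), one_smul]
    rfl
  map_zero' := by
    refine NatTrans.ext (funext fun n => ?_)
    rw [D.padicEnd_congr (a := 0) (by simp), zero_smul]
    rfl
  map_add' a b := by
    refine NatTrans.ext (funext fun n => ?_)
    rw [D.padicEnd_congr (a := residue a n + residue b n)
      (by rw [Nat.cast_add, residue_cast, residue_cast, map_add]), add_smul]
    rfl
  map_mul' a b := by
    refine NatTrans.ext (funext fun n => ?_)
    rw [D.padicEnd_congr (a := residue a n * residue b n)
      (by rw [Nat.cast_mul, residue_cast, residue_cast, map_mul])]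
    change _ = (residue b n • 𝟙 (D.G.obj n)) ≫ (residue a n • 𝟙 (D.G.obj n))
    rw [Preadditive.nsmul_comp, Preadditive.comp_nsmul, Category.id_comp, smul_smul, mul_comm]

/-- `End_S D` is a `ℤ_p`-algebra. -/
instance : Algebra ℤ_[p] D.EndRing :=
  D.padicEndHom.toAlgebra' fun z f => by
    refine NatTrans.ext (funext fun n => ?_)
    change f.app n ≫ (residue z n • 𝟙 (D.G.obj n)) = (residue z n • 𝟙 (D.G.obj n)) ≫ f.app n
    simp

/-- The action of `End_S D` on `D[p^n](T)`. -/
def ptsAction (n : ℕ) (T : Over S) : D.EndRing →ₐ[ℤ_[p]] Module.End ℤ_[p] (D.Pts n T) where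
  toFun f := ptsMap le_rfl (f.app n) T
  map_one' := by
    ext x; exact Category.comp_id x.hom
  map_mul' f g := by
    ext x; exact (Category.assoc x.hom (g.app n).hom.hom.hom (f.app n).hom.hom.hom).symm
  map_zero' := by
    ext x; exact MonObj.comp_one x.hom
  map_add' f g := by
    ext x; exact MonObj.comp_mul x.hom (f.app n).hom.hom.hom (g.app n).hom.hom.hom
  commutes' z := by
    ext x
    change toPts (x.hom ≫ (residue z n • 𝟙 (D.G.obj n)).hom.hom.hom) = residue z n • x
    rw [commGrp_nsmul_hom]
    change toPts (x.hom ≫ (𝟙 (D.G.obj n).X) ^ residue z n) = _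
    rw [MonObj.comp_pow, Category.comp_id]
    rfl

/-- The Tate module `T_p(D)(T) = lim D[p^n](T)` of sections over `T`: sequences `x n ∈ D[p^n](T)`
with `p • x (n + 1) = x n`. -/
def tate (T : Over S) : Submodule ℤ_[p] (∀ n, D.Pts n T) where
  carrier := {x | ∀ n, p • x (n + 1) = D.incl n T (x n)}
  zero_mem' n := by simp
  add_mem' {x y} hx hy n := by
    simp only [Pi.add_apply, smul_add, map_add, hx n, hy n]
  smul_mem' c x hx n := by
    simp only [Pi.smul_apply, map_smul, ← hx n]
    exact smul_comm _ _ _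

/-- The projection `T_p(D)(T) → D[p^n](T)`. -/
def tateProj (n : ℕ) (T : Over S) : D.tate T →ₗ[ℤ_[p]] D.Pts n T :=
  LinearMap.proj n ∘ₗ (D.tate T).subtype

variable {D D'} in
lemma ptsMap_incl (f : D.G ⟶ D'.G) (n : ℕ) (T : Over S) (x : D.Pts n T) :
    ptsMap le_rfl (f.app (n + 1)) T (D.incl n T x) =
      D'.incl n T (ptsMap le_rfl (f.app n) T x) := by
  have h := congrArg (fun g => g.hom.hom.hom) (f.naturality (homOfLE n.le_succ))
  change toPts ((x.hom ≫ (D.G.map (homOfLE n.le_succ)).hom.hom.hom) ≫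
    (f.app (n + 1)).hom.hom.hom) = toPts ((x.hom ≫ (f.app n).hom.hom.hom) ≫
      (D'.G.map (homOfLE n.le_succ)).hom.hom.hom)
  rw [Category.assoc, Category.assoc]
  exact congrArg (fun g => toPts (x.hom ≫ g)) h

variable {D D'} in
/-- The map on Tate modules induced by a homomorphism of `p`-divisible groups. -/
def tateMap (f : D.G ⟶ D'.G) (T : Over S) : D.tate T →ₗ[ℤ_[p]] D'.tate T where
  toFun x := ⟨fun n => ptsMap le_rfl (f.app n) T (x.1 n), fun n => by
    rw [← ptsMap_incl, ← x.2 n, map_nsmul]⟩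
  map_add' x y := by ext n; exact map_add _ _ _
  map_smul' c x := by ext n; exact LinearMap.map_smul _ _ _

variable {D D'} in
/-- The isomorphism of Tate modules induced by an isomorphism of `p`-divisible groups. -/
def tateEquiv (f : D.G ≅ D'.G) (T : Over S) : D.tate T ≃ₗ[ℤ_[p]] D'.tate T where
  __ := tateMap f.hom T
  invFun := tateMap f.inv T
  left_inv x := by
    ext n
    have h := congrArg (fun g => g.hom.hom.hom) (f.hom_inv_id_app n)
    change toPts (((x.1 n).hom ≫ (f.hom.app n).hom.hom.hom) ≫ (f.inv.app n).hom.hom.hom) = x.1 n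
    rw [Category.assoc]
    exact (congrArg (fun g => toPts ((x.1 n).hom ≫ g)) h).trans (Category.comp_id (x.1 n).hom)
  right_inv x := by
    ext n
    have h := congrArg (fun g => g.hom.hom.hom) (f.inv_hom_id_app n)
    change toPts (((x.1 n).hom ≫ (f.inv.app n).hom.hom.hom) ≫ (f.hom.app n).hom.hom.hom) = x.1 n
    rw [Category.assoc]
    exact (congrArg (fun g => toPts ((x.1 n).hom ≫ g)) h).trans (Category.comp_id (x.1 n).hom)

/-- The action of `End_S D` on the Tate module. -/
def tateAction (T : Over S) : D.EndRing →ₐ[ℤ_[p]] Module.End ℤ_[p] (D.tate T) where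
  toFun f := tateMap f T
  map_one' := by ext x n; exact congrArg (fun g => g (x.1 n)) (map_one (D.ptsAction n T))
  map_mul' f g := by
    ext x n; exact congrArg (fun g => g (x.1 n)) (map_mul (D.ptsAction n T) f g)
  map_zero' := by ext x n; exact congrArg (fun g => g (x.1 n)) (map_zero (D.ptsAction n T))
  map_add' f g := by
    ext x n; exact congrArg (fun g => g (x.1 n)) (map_add (D.ptsAction n T) f g)
  commutes' z := by
    ext x n; exact congrArg (fun g => g (x.1 n)) ((D.ptsAction n T).commutes z)

/-! ### The twist of a `p`-divisible group -/

variable {H B : Type v} [CommRing H] [HopfAlgebra ℤ_[p] H] [CommRing B] [Algebra ℤ_[p] B]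

/-- The group `D^P[p^n](T) = (D[p^n](T) ⊗ O_P)^Z`. -/
abbrev twistPts (ρ : GroupHom ℤ_[p] H D.EndRing) (P : Torsor ℤ_[p] H B) (n : ℕ) (T : Over S) :
    Submodule ℤ_[p] (B ⊗[ℤ_[p]] D.Pts n T) :=
  twist ρ P (D.ptsAction n T)

/-- The direct system of presheaves of groups `D^P[p^n]` is represented by the `p`-divisible
group `E`: isomorphisms `E[p^n](T) ≃ D^P[p^n](T)`, natural in `T` and compatible with the
transition maps in `n`. -/
structure TwistRep (ρ : GroupHom ℤ_[p] H D.EndRing) (P : Torsor ℤ_[p] H B)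
    (E : PDivGroup p S) where
  equiv : ∀ (n : ℕ) (T : Over S), E.Pts n T ≃+ D.twistPts ρ P n T
  equiv_res : ∀ (n : ℕ) {T T' : Over S} (f : T' ⟶ T) (x : E.Pts n T),
    (equiv n T' (E.res n f x) : B ⊗[ℤ_[p]] D.Pts n T') =
      LinearMap.lTensor B (D.res n f) (equiv n T x)
  equiv_incl : ∀ (n : ℕ) (T : Over S) (x : E.Pts n T),
    (equiv (n + 1) T (E.incl n T x) : B ⊗[ℤ_[p]] D.Pts (n + 1) T) =
      LinearMap.lTensor B (D.incl n T) (equiv n T x)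

/-! ### Tate tensors -/

/-- The geometric generic point `Spec Ω → S`. -/
def genPt (S : Scheme.{u}) [IsIntegral S] (Ω : Type u) [Field Ω] [Algebra S.functionField Ω] :
    Over S :=
  Over.mk (Spec.map (CommRingCat.ofHom (algebraMap S.functionField Ω)) ≫
    S.fromSpecStalk (genericPoint S))

variable {D} in
/-- `c` is the canonical isomorphism `T_p(D^P) ≅ T_p(D)^P = (T_p(D) ⊗ O_P)^Z`, extended to an
isomorphism `O_P ⊗ T_p(D^P) ≅ O_P ⊗ T_p(D)`: it maps `T_p(D^P)` onto `(T_p(D) ⊗ O_P)^Z`, in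
such a way that it lifts the given isomorphisms `D^P[p^n](T) ≅ (D[p^n](T) ⊗ O_P)^Z`. -/
structure IsTateComparison {ρ : GroupHom ℤ_[p] H D.EndRing} {P : Torsor ℤ_[p] H B}
    {E : PDivGroup p S} (e : D.TwistRep ρ P E) (T : Over S)
    (c : (B ⊗[ℤ_[p]] E.tate T) ≃ₗ[B] (B ⊗[ℤ_[p]] D.tate T)) : Prop where
  range_eq : Set.range (fun x : E.tate T => c (1 ⊗ₜ x)) = twist ρ P (D.tateAction T)
  lift : ∀ (n : ℕ) (x : E.tate T),
    LinearMap.lTensor B (D.tateProj n T) (c (1 ⊗ₜ x)) = e.equiv n T (E.tateProj n T x)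

variable {D} in
/-- The tensor `t ∈ T_p(D)^⊗` is `Z`-invariant: for every `A` and `z ∈ Z(A)`, its image in
`(A ⊗ T_p(D))^⊗` is fixed by `z`. -/
def IsInvariantTensor (ρ : GroupHom ℤ_[p] H D.EndRing) (T : Over S)
    (t : TensorSpace ℤ_[p] (D.tate T)) : Prop :=
  ∀ (A : Type v) [CommRing A] [Algebra ℤ_[p] A] (z : WithConv (H →ₐ[ℤ_[p]] A)),
    TensorSpace.map (ρ.act (D.tateAction T) z) (TensorSpace.ext ℤ_[p] A (D.tate T) t) =
      TensorSpace.ext ℤ_[p] A (D.tate T) t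

variable {D} in
/-- The tensor `t' ∈ T_p(D^P)^⊗` is the one given by `t ∈ T_p(D)^⊗`: over `O_P` they agree under
the isomorphism `c`. -/
def CorrespondingTensor {E : PDivGroup p S} {T : Over S}
    (c : (B ⊗[ℤ_[p]] E.tate T) ≃ₗ[B] (B ⊗[ℤ_[p]] D.tate T))
    (t' : TensorSpace ℤ_[p] (E.tate T)) (t : TensorSpace ℤ_[p] (D.tate T)) : Prop :=
  TensorSpace.map c (TensorSpace.ext ℤ_[p] B (E.tate T) t') =
    TensorSpace.ext ℤ_[p] B (D.tate T) t

end PDivGroup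

/-- The ideal `(p)` of `ℤ` is prime. -/
instance spanPrime : (Ideal.span {(p : ℤ)}).IsPrime :=
  (Ideal.span_singleton_prime (by exact_mod_cast (Fact.out : p.Prime).ne_zero)).2
    (Nat.prime_iff_prime_int.1 Fact.out)

/-- `Spec ℤ_(p)`. -/
abbrev specZLoc : Scheme.{u} :=
  Spec (CommRingCat.of (ULift.{u} (Localization.AtPrime (Ideal.span {(p : ℤ)}))))

end KisinTwist

end

open KisinTwist

noncomputable section

namespace KisinTwist

section Algebra

variable {R : Type w} [CommRing R] {H B : Type v} [CommRing H] [HopfAlgebra R H] [CommRing B]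
  [Algebra R B] {E : Type u} [Ring E] [Algebra R E]
  {M M' : Type*} [AddCommGroup M] [Module R M] [AddCommGroup M'] [Module R M']

/-! ### Points of a torsor -/

namespace Torsor

variable (P : Torsor R H B) {A A' : Type v} [CommRing A] [Algebra R A] [CommRing A'] [Algebra R A']

/-! A function `x` on the torsor with values in `M` lies in the twist when its values at any two
points over the same algebra correspond under the element of `Z` that relates these points
(`mem_twist_iff`). So the twist is given by a descent datum along `O_P`, called transport below.

Part (1). `O_P` need not be finite over `ℤ_p`, but `ℤ_p → O_P` splits as a map of modules, because
`ℤ_p` is compact and hence pure-injective (`exists_functional_one`). Transporting the value at a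
point `y` to all other points, and averaging over `y` with such a splitting, projects `O_P ⊗ M` onto
the twist, naturally in `M` (`twistProj_mem`, `twistProj_eq`). Transport is governed by one element
of `(O_P ⊗ O_P) ⊗ End D`. Writing it as a sum of `k` pure tensors makes the twist a retract of `M ^
k`, with the same `k` for every `M`. For `M = D[p^n](T)` this presents `D^P` as the image of an
idempotent of `D^k`. Such images are again finite locally free, and the axioms of a `p`-divisible
group pass to them.

Part (2). The torsor is trivial. On the special fibre, Frobenius moves the tautological point by an
element of `Z`, which defines the Lang map from the torsor to the group. It is integral
(`langMap_isIntegral`) and étale (`langMap_formallyEtale`), so its image is open and closed and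
contains the identity. A point above the identity is fixed by Frobenius, hence defined over `F_p`,
and it lifts to `ℤ_p` by smoothness and completeness (`Torsor.exists_point`).

Evaluation at a `ℤ_p`-point `y` is an isomorphism `D^P ≅ D`. The comparison over `O_P` is forced,
because an invariant function is determined by its value at `y` (`eq_comparison`). It equals the
base change of the map on Tate modules followed by the action of an element of `Z(O_P)`, which fixes
`t`. Hence `t'` corresponds to `t` exactly when the isomorphism maps `t'` to `t`
(`correspondingTensor_comparison_iff`). -/

lemma comp_smul (f : A →ₐ[R] A') (y : B →ₐ[R] A) (z : WithConv (H →ₐ[R] A)) :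
    f.comp (P.smul y z) = P.smul (f.comp y) (toConv (f.comp z.ofConv)) := by
  unfold Torsor.smul
  rw [← AlgHom.comp_assoc]
  congr 1
  ext <;> simp

lemma smul_one (y : B →ₐ[R] A) : P.smul y 1 = y := by
  have h := congrArg (fun g => y.comp g) P.coact_counit
  refine Eq.trans ?_ h
  unfold Torsor.smul
  simp only [← AlgHom.comp_assoc]
  congr 1
  ext
  · simp
  · simp [Algebra.algebraMap_eq_smul_one]

lemma smul_mul (y : B →ₐ[R] A) (z z' : WithConv (H →ₐ[R] A)) :
    P.smul y (z * z') = P.smul (P.smul y z) z' := by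
  have h := congrArg (fun g => (Algebra.TensorProduct.lift y (Algebra.TensorProduct.lift z.ofConv
    z'.ofConv (fun _ _ => Commute.all _ _)) (fun _ _ => Commute.all _ _)).comp g) P.coact_coassoc
  simp only [← AlgHom.comp_assoc] at h
  unfold Torsor.smul
  refine Eq.trans ?_ (h.symm.trans ?_)
  · congr 1
    apply Algebra.TensorProduct.ext
    · ext; simp
    · ext x
      simp [AlgHom.convMul_apply]
  · congr 1
    apply Algebra.TensorProduct.ext
    · ext b
      simp only [AlgHom.comp_apply, Algebra.TensorProduct.includeLeft_apply,
        Algebra.TensorProduct.map_tmul, Algebra.TensorProduct.lift_tmul, map_one, mul_one]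
      induction P.coact b with
      | zero => simp
      | add x y hx hy => simp only [TensorProduct.add_tmul, map_add, hx, hy]
      | tmul x y => simp
    · ext x
      have : (1 : B ⊗[R] H) ⊗ₜ[R] x = ((1 : B) ⊗ₜ[R] (1 : H)) ⊗ₜ[R] x := rfl
      simp [this]

/-- Inverting the torsor isomorphism `P × Z → P × P` turns the pair `(y, y')` into a pair `(y, z)`.
-/
lemma existsUnique_smul_eq (y y' : B →ₐ[R] A) : ∃! z : WithConv (H →ₐ[R] A), P.smul y z = y' := by
  let Ψ : B ⊗[R] B ≃ₐ[R] B ⊗[R] H := AlgEquiv.ofBijective (Algebra.TensorProduct.lift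
    (Algebra.TensorProduct.includeLeft : B →ₐ[R] B ⊗[R] H) P.coact (fun _ _ => Commute.all _ _))
    P.bijective
  have hl : ∀ b : B, Ψ (b ⊗ₜ 1) = b ⊗ₜ 1 := fun b => by simp [Ψ]
  have hr : ∀ b : B, Ψ (1 ⊗ₜ b) = P.coact b := fun b =>
    (Algebra.TensorProduct.lift_tmul _ _ (fun _ _ => Commute.all _ _) _ _).trans
      ((congrArg (· * P.coact b) (map_one _)).trans (one_mul _))
  let θ : B ⊗[R] H →ₐ[R] A :=
    (Algebra.TensorProduct.lift y y' (fun _ _ => Commute.all _ _)).comp Ψ.symm.toAlgHom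
  have hθ : ∀ b : B, θ (b ⊗ₜ 1) = y b := fun b => by
    simp [θ, ← hl b, AlgEquiv.symm_apply_apply]
  have hθ' : ∀ b : B, θ (P.coact b) = y' b := fun b => by
    simp [θ, ← hr b, AlgEquiv.symm_apply_apply]
  refine ⟨toConv (θ.comp Algebra.TensorProduct.includeRight), ?_, ?_⟩
  · ext b
    rw [← hθ' b]
    unfold Torsor.smul
    rw [AlgHom.comp_apply]
    congr 1
    ext x
    · simp [hθ]
    · simp
  · intro z hz
    apply WithConv.ofConv_injective
    have : Algebra.TensorProduct.lift y z.ofConv (fun _ _ => Commute.all _ _) = θ := by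
      have h2 : (Algebra.TensorProduct.lift y z.ofConv (fun _ _ => Commute.all _ _)).comp Ψ.toAlgHom
          = θ.comp Ψ.toAlgHom := by
        ext b
        · simp [hl, hθ]
        · have := congrArg (fun g => g b) hz
          unfold Torsor.smul at this
          simpa [hr, hθ'] using this
      ext x
      · simp [hθ]
      · have := congrArg (fun g => g (Ψ.symm (1 ⊗ₜ x))) h2
        simpa using this
    rw [← this]
    ext; simp

/-- The element `z ∈ Z(A)` with `y z = y'`. -/
def div (y y' : B →ₐ[R] A) : WithConv (H →ₐ[R] A) := (P.existsUnique_smul_eq y y').choose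

lemma smul_div (y y' : B →ₐ[R] A) : P.smul y (P.div y y') = y' :=
  (P.existsUnique_smul_eq y y').choose_spec.1

lemma div_eq {y y' : B →ₐ[R] A} {z : WithConv (H →ₐ[R] A)} (h : P.smul y z = y') :
    P.div y y' = z :=
  (P.existsUnique_smul_eq y y').unique (P.smul_div y y') h

lemma div_smul (y : B →ₐ[R] A) (z : WithConv (H →ₐ[R] A)) : P.div y (P.smul y z) = z :=
  P.div_eq rfl

lemma div_self (y : B →ₐ[R] A) : P.div y y = 1 := P.div_eq (P.smul_one y)

lemma div_mul_div (y y' y'' : B →ₐ[R] A) : P.div y y' * P.div y' y'' = P.div y y'' :=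
  (P.div_eq (by rw [smul_mul, smul_div, smul_div])).symm

/-- Uniqueness of the quotient makes it natural in the algebra. -/
lemma div_comp (f : A →ₐ[R] A') (y y' : B →ₐ[R] A) :
    P.div (f.comp y) (f.comp y') = toConv (f.comp (P.div y y').ofConv) :=
  P.div_eq (by rw [← comp_smul, smul_div])

end Torsor

/-! ### Change of rings and modules -/

/-- The action of `A ⊗ E` on `A ⊗ M`, for an `E`-module `M`. -/
def tensorAct (A : Type*) [CommRing A] [Algebra R A] (θ : E →ₐ[R] Module.End R M) :
    A ⊗[R] E →ₐ[A] Module.End A (A ⊗[R] M) :=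
  (LinearMap.tensorProductEnd R A M).comp (Algebra.TensorProduct.map (AlgHom.id A A) θ)

lemma tensorAct_tmul {A : Type*} [CommRing A] [Algebra R A] (θ : E →ₐ[R] Module.End R M)
    (a a' : A) (e : E) (m : M) : tensorAct A θ (a ⊗ₜ e) (a' ⊗ₜ m) = (a * a') ⊗ₜ θ e m := by
  rw [tensorAct, AlgHom.comp_apply, Algebra.TensorProduct.map_tmul]
  change (LinearMap.tensorProduct R A M M (a ⊗ₜ θ e)) (a' ⊗ₜ m) = _
  simp [LinearMap.tensorProduct, TensorProduct.smul_tmul']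

/-- Contraction of `a ⊗ m` along a linear map applied to the first factor is compatible with the
action of `E`, provided the linear map is semilinear along a ring homomorphism. -/
lemma rTensor_tensorAct {A A' C : Type*} [CommRing A] [Algebra R A] [CommRing A'] [Algebra R A']
    [CommRing C] [Algebra R C]
    (θ : E →ₐ[R] Module.End R M) (g : C →ₐ[R] A) (g' : C →ₐ[R] A') (f : A →ₗ[R] A')
    (hf : ∀ c a, f (g c * a) = g' c * f a) (x : C ⊗[R] E) (m : A ⊗[R] M) :
    LinearMap.rTensor M f (tensorAct A θ (Algebra.TensorProduct.map g (AlgHom.id R E) x) m) =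
      tensorAct A' θ (Algebra.TensorProduct.map g' (AlgHom.id R E) x)
        (LinearMap.rTensor M f m) := by
  induction x with
  | zero => simp
  | add x y hx hy => simp only [map_add, LinearMap.add_apply, hx, hy]
  | tmul c e =>
    induction m with
    | zero => simp
    | add x y hx hy => simp only [map_add, hx, hy]
    | tmul a m =>
      simp only [Algebra.TensorProduct.map_tmul, tensorAct_tmul, LinearMap.rTensor_tmul, hf]

lemma lTensor_tensorAct {A : Type*} [CommRing A] [Algebra R A] (θ : E →ₐ[R] Module.End R M)
    (θ' : E →ₐ[R] Module.End R M') (g : M →ₗ[R] M') (hg : ∀ e m, g (θ e m) = θ' e (g m))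
    (x : A ⊗[R] E) (m : A ⊗[R] M) :
    LinearMap.lTensor A g (tensorAct A θ x m) = tensorAct A θ' x (LinearMap.lTensor A g m) := by
  induction x with
  | zero => simp
  | add x y hx hy => simp only [map_add, LinearMap.add_apply, hx, hy]
  | tmul c e =>
    induction m with
    | zero => simp
    | add x y hx hy => simp only [map_add, hx, hy]
    | tmul a m => simp only [tensorAct_tmul, LinearMap.lTensor_tmul, hg]

namespace GroupHom

variable (ρ : GroupHom R H E) (θ : E →ₐ[R] Module.End R M) (θ' : E →ₐ[R] Module.End R M')
  {A A' : Type v} [CommRing A] [Algebra R A] [CommRing A'] [Algebra R A']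

lemma act_apply (z : WithConv (H →ₐ[R] A)) (x : A ⊗[R] M) :
    ρ.act θ z x = tensorAct A θ (ρ.app A z : A ⊗[R] E) x := rfl

lemma act_one (x : A ⊗[R] M) : ρ.act θ (1 : WithConv (H →ₐ[R] A)) x = x := by
  simp [act_apply]

lemma act_mul (z z' : WithConv (H →ₐ[R] A)) (x : A ⊗[R] M) :
    ρ.act θ (z * z') x = ρ.act θ z (ρ.act θ z' x) := by
  simp [act_apply]

/-- Semilinearity over `C`, where `z` lives, is enough. Besides ring homomorphisms this covers
contractions along functionals, which do the averaging. -/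
lemma rTensor_act {C : Type v} [CommRing C] [Algebra R C] (g : C →ₐ[R] A) (g' : C →ₐ[R] A')
    (f : A →ₗ[R] A') (hf : ∀ c a, f (g c * a) = g' c * f a) (z : WithConv (H →ₐ[R] C))
    (m : A ⊗[R] M) :
    LinearMap.rTensor M f (ρ.act θ (toConv (g.comp z.ofConv)) m) =
      ρ.act θ (toConv (g'.comp z.ofConv)) (LinearMap.rTensor M f m) := by
  rw [act_apply, act_apply, ρ.naturality, ρ.naturality]
  exact rTensor_tensorAct θ g g' f hf _ _

lemma lTensor_act (g : M →ₗ[R] M') (hg : ∀ e m, g (θ e m) = θ' e (g m))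
    (z : WithConv (H →ₐ[R] A)) (m : A ⊗[R] M) :
    LinearMap.lTensor A g (ρ.act θ z m) = ρ.act θ' z (LinearMap.lTensor A g m) :=
  lTensor_tensorAct θ θ' g hg _ _

/-- Functions in the twist transport the value at `y` to the value at `y'`. -/
def transport (P : Torsor R H B) (y y' : B →ₐ[R] A) : (A ⊗[R] M) ≃ₗ[A] (A ⊗[R] M) :=
  ρ.act θ (P.div y' y)

variable (P : Torsor R H B)

lemma transport_apply (y y' : B →ₐ[R] A) (x : A ⊗[R] M) :
    ρ.transport θ P y y' x = ρ.act θ (P.div y' y) x := rfl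

lemma transport_self (y : B →ₐ[R] A) (x : A ⊗[R] M) : ρ.transport θ P y y x = x := by
  rw [transport_apply, P.div_self, act_one]

/-- The cocycle condition of the descent datum. -/
lemma transport_trans (y y' y'' : B →ₐ[R] A) (x : A ⊗[R] M) :
    ρ.transport θ P y' y'' (ρ.transport θ P y y' x) = ρ.transport θ P y y'' x := by
  simp only [transport_apply, ← act_mul, P.div_mul_div]

lemma rTensor_transport {C : Type v} [CommRing C] [Algebra R C] (g : C →ₐ[R] A) (g' : C →ₐ[R] A')
    (f : A →ₗ[R] A') (hf : ∀ c a, f (g c * a) = g' c * f a) (y y' : B →ₐ[R] C) (m : A ⊗[R] M) :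
    LinearMap.rTensor M f (ρ.transport θ P (g.comp y) (g.comp y') m) =
      ρ.transport θ P (g'.comp y) (g'.comp y') (LinearMap.rTensor M f m) := by
  simp only [transport_apply, P.div_comp]
  exact ρ.rTensor_act θ g g' f hf _ _

lemma evalAt_transport (f : A →ₐ[R] A') (y y' : B →ₐ[R] A) (m : A ⊗[R] M) :
    LinearMap.rTensor M f.toLinearMap (ρ.transport θ P y y' m) =
      ρ.transport θ P (f.comp y) (f.comp y') (LinearMap.rTensor M f.toLinearMap m) :=
  ρ.rTensor_transport θ P (AlgHom.id R A) f f.toLinearMap (by simp) y y' m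

lemma lTensor_transport (g : M →ₗ[R] M') (hg : ∀ e m, g (θ e m) = θ' e (g m))
    (y y' : B →ₐ[R] A) (m : A ⊗[R] M) :
    LinearMap.lTensor A g (ρ.transport θ P y y' m) =
      ρ.transport θ' P y y' (LinearMap.lTensor A g m) := by
  simp only [transport_apply]
  exact ρ.lTensor_act θ θ' g hg _ _

/-- Two points over `A` differ by a unique element of `Z(A)`, so quantifying over `(y, z)` is the
same as quantifying over pairs of points. -/
lemma mem_twist_iff (x : B ⊗[R] M) : x ∈ twist ρ P θ ↔
    ∀ (A : Type v) [CommRing A] [Algebra R A] (y y' : B →ₐ[R] A),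
      ρ.transport θ P y y' (evalAt M y x) = evalAt M y' x := by
  constructor
  · intro h A _ _ y y'
    have := h A y' (P.div y' y)
    rwa [P.smul_div] at this
  · intro h A _ _ y z
    rw [← h A (P.smul y z) y, transport_apply, P.div_smul]

end GroupHom

end Algebra

end KisinTwist
end

noncomputable section

namespace KisinTwist

/-! ### Linear functionals over `ℤ_p` -/

section Functional

variable {p : ℕ} [Fact p.Prime] {N : Type*} [AddCommGroup N] [Module ℤ_[p] N]

/-- The module is free, and some coordinate of `x` is a unit because `x` is not divisible by `p`.
Rescale that coordinate. -/
lemma exists_functional_of_finite [Module.IsTorsionFree ℤ_[p] N] [Module.Finite ℤ_[p] N] {x : N}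
    (hx : ∀ y : N, (p : ℤ_[p]) • y ≠ x) : ∃ l : N →ₗ[ℤ_[p]] ℤ_[p], l x = 1 := by
  have : Module.Free ℤ_[p] N := Module.free_of_finite_type_torsion_free'
  let b := Module.Free.chooseBasis ℤ_[p] N
  by_cases h : ∃ i, IsUnit (b.coord i x)
  · obtain ⟨i, hi⟩ := h
    obtain ⟨u, hu⟩ := hi
    refine ⟨(↑u⁻¹ : ℤ_[p]) • b.coord i, ?_⟩
    rw [LinearMap.smul_apply, ← hu]
    simp
  · push Not at h
    have h2 : ∀ i, ∃ c : ℤ_[p], b.coord i x = p * c := fun i => by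
      have := (IsLocalRing.mem_maximalIdeal _).2 (h i)
      rwa [PadicInt.maximalIdeal_eq_span_p, Ideal.mem_span_singleton] at this
    choose c hc using h2
    refine absurd ?_ (hx (∑ i, c i • b i))
    rw [Finset.smul_sum, ← b.sum_repr x]
    refine Finset.sum_congr rfl fun i _ => ?_
    rw [smul_smul, ← hc]
    rfl

/-- `ℤ_p` is pure-injective: an element of a torsion-free module that is not divisible by `p`
takes the value `1` under some functional. -/
theorem exists_functional [Module.IsTorsionFree ℤ_[p] N] {x : N}
    (hx : ∀ y : N, (p : ℤ_[p]) • y ≠ x) : ∃ l : N →ₗ[ℤ_[p]] ℤ_[p], l x = 1 := by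
  classical
  let W (s : Finset N) : Submodule ℤ_[p] N := Submodule.span ℤ_[p] (insert x s : Finset N)
  have hxW (s : Finset N) : x ∈ W s := Submodule.subset_span (by simp)
  have key (s : Finset N) : ∃ l : W s →ₗ[ℤ_[p]] ℤ_[p], l ⟨x, hxW s⟩ = 1 := by
    have : Module.Finite ℤ_[p] (W s) := Module.Finite.span_finset _ _
    exact exists_functional_of_finite fun y hy => hx y (congrArg Subtype.val hy)
  choose l hl using key
  -- The value `0` outside `W s` is harmless: each `y` lies in `W s` for all large `s`.
  let f (s : Finset N) (y : N) : ℤ_[p] := if h : y ∈ W s then l s ⟨y, h⟩ else 0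
  let U : Ultrafilter (Finset N) := Ultrafilter.of Filter.atTop
  have hmem (y : N) : ∀ᶠ s in (U : Filter (Finset N)), y ∈ W s := by
    refine (Ultrafilter.of_le Filter.atTop) ?_
    filter_upwards [Filter.eventually_ge_atTop {y}] with s hs
    exact Submodule.subset_span (by simpa using Or.inr (hs (by simp)))
  -- `N → ℤ_p` is compact by Tychonoff, so the functions `f s` converge along the ultrafilter. The
  -- identities of a functional hold eventually, hence in the limit.
  obtain ⟨g, hg⟩ : ∃ g : N → ℤ_[p], Filter.Tendsto f U (nhds g) :=
    ⟨_, (U.map f).le_nhds_lim⟩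
  rw [tendsto_pi_nhds] at hg
  refine ⟨{ toFun := g, map_add' := fun a b => ?_, map_smul' := fun c a => ?_ }, ?_⟩
  · refine tendsto_nhds_unique (hg (a + b)) (((hg a).add (hg b)).congr' ?_)
    filter_upwards [hmem a, hmem b] with s ha hb
    simp only [f, ha, hb, (W s).add_mem ha hb, dif_pos, ← map_add]
    rfl
  · refine tendsto_nhds_unique (hg (c • a)) (((hg a).const_smul c).congr' ?_)
    filter_upwards [hmem a] with s ha
    simp only [f, ha, (W s).smul_mem c ha, dif_pos, ← map_smul]
    rfl
  · refine tendsto_nhds_unique (hg x) (tendsto_const_nhds.congr fun s => ?_)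
    simp only [f, hxW s, dif_pos, hl]

/-- Flatness gives torsion-freeness, and faithful flatness gives `pB ≠ B`, so `1` is not divisible
by `p`. -/
lemma exists_functional_one {B : Type*} [CommRing B] [Algebra ℤ_[p] B]
    [Module.FaithfullyFlat ℤ_[p] B] : ∃ l : B →ₗ[ℤ_[p]] ℤ_[p], l 1 = 1 := by
  refine exists_functional fun y hy => ?_
  refine Module.FaithfullyFlat.submodule_ne_top (M := B)
    (IsLocalRing.maximalIdeal.isMaximal ℤ_[p]) (eq_top_iff.2 fun z _ => ?_)
  have : z = (p : ℤ_[p]) • (y * z) := by rw [← smul_mul_assoc, hy, one_mul]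
  rw [this]
  refine Submodule.smul_mem_smul ?_ trivial
  rw [PadicInt.maximalIdeal_eq_span_p]
  exact Ideal.mem_span_singleton_self _

end Functional

section Algebra

variable {R : Type w} [CommRing R] {H B : Type v} [CommRing H] [HopfAlgebra R H] [CommRing B]
  [Algebra R B] {E : Type u} [Ring E] [Algebra R E]
  {M M' : Type*} [AddCommGroup M] [Module R M] [AddCommGroup M'] [Module R M']

/-! ### The twist as a retract -/

/-- The contraction `A ⊗ M → M` along a functional on `A`. -/
def contract {A : Type*} [AddCommGroup A] [Module R A] (M : Type*) [AddCommGroup M] [Module R M]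
    (l : A →ₗ[R] R) : A ⊗[R] M →ₗ[R] M :=
  (TensorProduct.lid R M).toLinearMap ∘ₗ LinearMap.rTensor M l

lemma contract_tmul {A : Type*} [AddCommGroup A] [Module R A] (l : A →ₗ[R] R) (a : A) (m : M) :
    contract M l (a ⊗ₜ m) = l a • m := by
  simp [contract]

lemma contract_lTensor {A : Type*} [AddCommGroup A] [Module R A] (l : A →ₗ[R] R) (g : M →ₗ[R] M')
    (x : A ⊗[R] M) : contract M' l (LinearMap.lTensor A g x) = g (contract M l x) := by
  induction x with
  | zero => simp
  | add x y hx hy => simp only [map_add, hx, hy]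
  | tmul a m => simp [contract_tmul]

/-- Contraction of the first factor is linear over the second, so it commutes with transport between
points of the second factor. -/
lemma contract_mul {C A : Type*} [CommRing C] [Algebra R C] [CommRing A] [Algebra R A]
    (l : C →ₗ[R] R) (a : A) (x : C ⊗[R] A) :
    contract A l ((1 ⊗ₜ a) * x) = a * contract A l x := by
  induction x with
  | zero => simp
  | add x y hx hy => simp only [mul_add, map_add, hx, hy]
  | tmul a m => simp [contract_tmul]

lemma algHom_contract {C A A' : Type*} [CommRing C] [Algebra R C] [CommRing A] [Algebra R A]
    [CommRing A'] [Algebra R A'] (l : C →ₗ[R] R) (f : A →ₐ[R] A') (x : C ⊗[R] A) :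
    f (contract A l x) = contract A' l (Algebra.TensorProduct.map (AlgHom.id R C) f x) := by
  induction x with
  | zero => simp
  | add x y hx hy => simp only [map_add, hx, hy]
  | tmul a m => simp [contract_tmul]

namespace GroupHom

variable (ρ : GroupHom R H E) (θ : E →ₐ[R] Module.End R M) (θ' : E →ₐ[R] Module.End R M')
  (P : Torsor R H B)

/-- A projection of `B ⊗ M` onto the twist: transport the value at a point `y` to all other points,
and average over `y` by means of a functional on `B`. -/
def twistProj (l : B →ₗ[R] R) : B ⊗[R] M →ₗ[R] B ⊗[R] M :=
  LinearMap.rTensor M (contract B l) ∘ₗ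
    ((ρ.transport θ P Algebra.TensorProduct.includeLeft
      Algebra.TensorProduct.includeRight).toLinearMap.restrictScalars R) ∘ₗ
    evalAt M (Algebra.TensorProduct.includeLeft : B →ₐ[R] B ⊗[R] B)

lemma twistProj_apply (l : B →ₗ[R] R) (x : B ⊗[R] M) : ρ.twistProj θ P l x =
    LinearMap.rTensor M (contract B l) (ρ.transport θ P Algebra.TensorProduct.includeLeft
      Algebra.TensorProduct.includeRight (evalAt M Algebra.TensorProduct.includeLeft x)) := rfl

/-- The averaging is compatible with base change along `y`: the value at `y` averages, over the
universal first point, the values transported to `y`. -/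
lemma evalAt_twistProj (l : B →ₗ[R] R) (x : B ⊗[R] M) {A : Type v} [CommRing A] [Algebra R A]
    (y : B →ₐ[R] A) : evalAt M y (ρ.twistProj θ P l x) =
      LinearMap.rTensor M (contract A l) (ρ.transport θ P Algebra.TensorProduct.includeLeft
        (Algebra.TensorProduct.includeRight.comp y)
          (evalAt M Algebra.TensorProduct.includeLeft x)) := by
  let f : B ⊗[R] B →ₐ[R] B ⊗[R] A := Algebra.TensorProduct.map (AlgHom.id R B) y
  have hl : f.comp Algebra.TensorProduct.includeLeft = Algebra.TensorProduct.includeLeft := by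
    ext; simp [f]
  have hr : f.comp Algebra.TensorProduct.includeRight =
      Algebra.TensorProduct.includeRight.comp y := by
    ext; simp [f]
  have hc : y.toLinearMap ∘ₗ contract B l = contract A l ∘ₗ f.toLinearMap :=
    LinearMap.ext fun x => algHom_contract l y x
  rw [twistProj_apply]
  unfold evalAt
  rw [← LinearMap.rTensor_comp_apply, hc, LinearMap.rTensor_comp_apply, evalAt_transport, hl, hr,
    ← LinearMap.rTensor_comp_apply, ← hl]
  rfl

/-- Transport from `y` to `y'` passes inside the average, where the cocycle condition absorbs it. -/
lemma twistProj_mem (l : B →ₗ[R] R) (x : B ⊗[R] M) : ρ.twistProj θ P l x ∈ twist ρ P θ := by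
  rw [mem_twist_iff]
  intro A _ _ y y'
  rw [evalAt_twistProj, evalAt_twistProj]
  have h := ρ.rTensor_transport θ P (Algebra.TensorProduct.includeRight : A →ₐ[R] B ⊗[R] A)
    (AlgHom.id R A) (contract A l) (fun c a => contract_mul l c a) y y'
  simp only [AlgHom.id_comp] at h
  rw [← h, transport_trans]

/-- For invariant `x`, transport from the first to the second point yields `x` at the second point,
independent of the first. Averaging this constant multiplies it by `l 1 = 1`. -/
lemma twistProj_eq {l : B →ₗ[R] R} (hl : l 1 = 1) {x : B ⊗[R] M} (hx : x ∈ twist ρ P θ) :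
    ρ.twistProj θ P l x = x := by
  rw [mem_twist_iff] at hx
  rw [twistProj_apply, hx]
  unfold evalAt
  rw [← LinearMap.rTensor_comp_apply]
  have : contract B l ∘ₗ (Algebra.TensorProduct.includeRight : B →ₐ[R] B ⊗[R] B).toLinearMap =
      LinearMap.id := by
    ext b; simp [contract_tmul, hl]
  rw [this, LinearMap.rTensor_id_apply]

/-- Naturality in the module: it makes the projection compatible with restriction along `T' → T` and
with the inclusions between levels. -/
lemma lTensor_twistProj (l : B →ₗ[R] R) (g : M →ₗ[R] M') (hg : ∀ e m, g (θ e m) = θ' e (g m))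
    (x : B ⊗[R] M) :
    LinearMap.lTensor B g (ρ.twistProj θ P l x) = ρ.twistProj θ' P l (LinearMap.lTensor B g x) := by
  have h {A A' : Type v} [CommRing A] [Algebra R A] [CommRing A'] [Algebra R A']
      (f : A →ₗ[R] A') (x : A ⊗[R] M) : LinearMap.lTensor A' g (LinearMap.rTensor M f x) =
        LinearMap.rTensor M' f (LinearMap.lTensor A g x) := by
    rw [← LinearMap.comp_apply, LinearMap.lTensor_comp_rTensor, ← LinearMap.rTensor_comp_lTensor,
      LinearMap.comp_apply]
  rw [twistProj_apply, twistProj_apply, h, ρ.lTensor_transport θ θ' P g hg]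
  unfold evalAt
  rw [h]

/-- The universal transport element of `(B ⊗ B) ⊗ E`. -/
def transportElt : (B ⊗[R] B) ⊗[R] E :=
  (ρ.app (B ⊗[R] B) (P.div Algebra.TensorProduct.includeRight Algebra.TensorProduct.includeLeft) :
    (B ⊗[R] B) ⊗[R] E)

/-- The projection to the twist factors through a finite power of `M`, in terms of an expression
of the universal transport element as a sum of pure tensors. -/
lemma twistProj_eq_sum (l : B →ₗ[R] R) {J : Type*} [Fintype J] {b b' : J → B} {e : J → E}
    (h : ρ.transportElt P = ∑ i, (b i ⊗ₜ b' i) ⊗ₜ e i) (x : B ⊗[R] M) :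
    ρ.twistProj θ P l x =
      ∑ i, b' i ⊗ₜ θ (e i) (contract M (l ∘ₗ LinearMap.mulLeft R (b i)) x) := by
  have h' : ρ.twistProj θ P l x = LinearMap.rTensor M (contract B l)
      (tensorAct _ θ (ρ.transportElt P) (evalAt M Algebra.TensorProduct.includeLeft x)) := rfl
  rw [h', h]
  clear h'
  induction x with
  | zero => simp
  | add x y hx hy => simp only [map_add, hx, hy, TensorProduct.tmul_add, Finset.sum_add_distrib]
  | tmul c m =>
    simp only [map_sum, LinearMap.sum_apply, evalAt, LinearMap.rTensor_tmul, AlgHom.toLinearMap_apply,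
      Algebra.TensorProduct.includeLeft_apply, tensorAct_tmul, contract_tmul,
      Algebra.TensorProduct.tmul_mul_tmul, mul_one, LinearMap.comp_apply,
      LinearMap.mulLeft_apply, map_smul, TensorProduct.smul_tmul]

end GroupHom

lemma exists_sum_tmul_tmul_eq {X Y Z : Type*} [AddCommGroup X] [Module R X] [AddCommGroup Y]
    [Module R Y] [AddCommGroup Z] [Module R Z] (t : (X ⊗[R] Y) ⊗[R] Z) :
    ∃ (k : ℕ) (x : Fin k → X) (y : Fin k → Y) (z : Fin k → Z),
      t = ∑ i, (x i ⊗ₜ[R] y i) ⊗ₜ[R] z i := by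
  suffices h : ∃ (J : Type) (_ : Fintype J) (x : J → X) (y : J → Y) (z : J → Z),
      t = ∑ i, (x i ⊗ₜ[R] y i) ⊗ₜ[R] z i by
    obtain ⟨J, _, x, y, z, h⟩ := h
    refine ⟨Fintype.card J, x ∘ (Fintype.equivFin J).symm, y ∘ (Fintype.equivFin J).symm,
      z ∘ (Fintype.equivFin J).symm, ?_⟩
    rw [h]
    exact ((Fintype.equivFin J).symm.sum_comp fun i => (x i ⊗ₜ[R] y i) ⊗ₜ[R] z i).symm
  obtain ⟨k, s, z, h⟩ := TensorProduct.exists_sum_tmul_eq t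
  choose j x y hxy using fun i => TensorProduct.exists_sum_tmul_eq (s i)
  refine ⟨Σ i, Fin (j i), inferInstance, fun a => x a.1 a.2, fun a => y a.1 a.2,
    fun a => z a.1, ?_⟩
  rw [h, Fintype.sum_sigma]
  refine Finset.sum_congr rfl fun i _ => ?_
  rw [hxy, TensorProduct.sum_tmul]

/-! ### Trivialization of the twist by a point of the torsor -/

namespace Torsor

variable (P : Torsor R H B)

/-- A point of the torsor over the base ring, as a point over `B`. -/
abbrev constPt (A : Type v) [CommRing A] [Algebra R A] (y : B →ₐ[R] R) : B →ₐ[R] A :=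
  (Algebra.ofId R A).comp y

end Torsor

lemma evalAt_constPt (y : B →ₐ[R] R) (A : Type v) [CommRing A] [Algebra R A] (x : B ⊗[R] M) :
    evalAt M (Torsor.constPt A y) x = 1 ⊗ₜ contract M y.toLinearMap x := by
  induction x with
  | zero => simp
  | add x z hx hz => simp only [map_add, hx, hz, TensorProduct.tmul_add]
  | tmul b m =>
    simp [contract_tmul, evalAt, Torsor.constPt, Algebra.ofId_apply, Algebra.algebraMap_eq_smul_one,
      TensorProduct.smul_tmul]

namespace GroupHom

variable (ρ : GroupHom R H E) (θ : E →ₐ[R] Module.End R M) (θ' : E →ₐ[R] Module.End R M')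
  (P : Torsor R H B) (y : B →ₐ[R] R)

/-- The function on the torsor with constant value `x` at the point `y`, extended by
transport. -/
def spread : (B ⊗[R] M) ≃ₗ[B] (B ⊗[R] M) :=
  (ρ.act θ (P.div (Torsor.constPt B y) (AlgHom.id R B))).symm

/-- The quotients of two points in the two orders are inverse to each other. The form with an
inverse lets the invariance of a tensor apply directly later on. -/
lemma spread_apply (x : B ⊗[R] M) :
    ρ.spread θ P y x = ρ.transport θ P (Torsor.constPt B y) (AlgHom.id R B) x := by
  rw [spread, LinearEquiv.symm_apply_eq, transport_apply, ← act_mul, P.div_mul_div, P.div_self,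
    act_one]

lemma evalAt_spread {A : Type v} [CommRing A] [Algebra R A] (f : B →ₐ[R] A) (m : M) :
    evalAt M f (ρ.spread θ P y (1 ⊗ₜ m)) =
      ρ.transport θ P (Torsor.constPt A y) f (1 ⊗ₜ m) := by
  rw [spread_apply]
  unfold evalAt
  rw [evalAt_transport, ← AlgHom.comp_assoc, AlgHom.comp_id, LinearMap.rTensor_tmul,
    show f.comp (Algebra.ofId R B) = Algebra.ofId R A from Subsingleton.elim _ _]
  simp

lemma spread_mem (m : M) : ρ.spread θ P y (1 ⊗ₜ m) ∈ twist ρ P θ := by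
  rw [mem_twist_iff]
  intro A _ _ f f'
  rw [evalAt_spread, evalAt_spread, transport_trans]

lemma contract_spread (m : M) :
    contract M y.toLinearMap (ρ.spread θ P y (1 ⊗ₜ m)) = m := by
  have h := ρ.evalAt_spread θ P y (Torsor.constPt B y) m
  rw [transport_self, evalAt_constPt] at h
  simpa [contract_tmul] using congrArg (contract M y.toLinearMap) h

/-- An invariant function is recovered from its value at the single point `y`. -/
lemma spread_contract {x : B ⊗[R] M} (hx : x ∈ twist ρ P θ) :
    ρ.spread θ P y (1 ⊗ₜ contract M y.toLinearMap x) = x := by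
  rw [mem_twist_iff] at hx
  have := hx B (Torsor.constPt B y) (AlgHom.id R B)
  rw [evalAt_constPt, ← spread_apply] at this
  rw [this]
  exact LinearMap.rTensor_id_apply _ _ _

lemma lTensor_spread (g : M →ₗ[R] M') (hg : ∀ e m, g (θ e m) = θ' e (g m)) (x : B ⊗[R] M) :
    LinearMap.lTensor B g (ρ.spread θ P y x) = ρ.spread θ' P y (LinearMap.lTensor B g x) := by
  rw [spread_apply, spread_apply, ρ.lTensor_transport θ θ' P g hg]

/-- A point of the torsor over the base ring identifies the twist of `M` with `M`. -/
def trivialize : twist ρ P θ ≃ₗ[R] M where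
  __ := contract M y.toLinearMap ∘ₗ (twist ρ P θ).subtype
  invFun m := ⟨ρ.spread θ P y (1 ⊗ₜ m), ρ.spread_mem θ P y m⟩
  left_inv x := Subtype.ext (ρ.spread_contract θ P y x.2)
  right_inv m := ρ.contract_spread θ P y m

end GroupHom

end Algebra

end KisinTwist
end

noncomputable section

namespace KisinTwist

/-! ### Cancellation in torsors, and their smoothness -/

section Points

variable {R : Type w} [CommRing R] {H B : Type v} [CommRing H] [HopfAlgebra R H] [CommRing B]
  [Algebra R B]

namespace Torsor

variable (P : Torsor R H B)

lemma smul_injective {A : Type v} [CommRing A] [Algebra R A] (y : B →ₐ[R] A) :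
    Function.Injective (P.smul y) := fun z z' h => by
  rw [← P.div_smul y z, ← P.div_smul y z', h]

/-- `P.div (P.smul y z) y` is the inverse of `z`, whatever `y` is. -/
lemma smul_div_smul {A : Type v} [CommRing A] [Algebra R A] (y y' : B →ₐ[R] A)
    (z : WithConv (H →ₐ[R] A)) : P.smul (P.smul y' z) (P.div (P.smul y z) y) = y' := by
  have h : z * P.div (P.smul y z) y = 1 := P.smul_injective y (by
    rw [P.smul_mul, P.smul_div, P.smul_one])
  rw [← P.smul_mul, h, P.smul_one]

lemma smul_right_cancel {A : Type v} [CommRing A] [Algebra R A] {y y' : B →ₐ[R] A}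
    {z : WithConv (H →ₐ[R] A)} (h : P.smul y z = P.smul y' z) : y = y' := by
  have h' := P.smul_div_smul y y z
  have h'' := P.smul_div_smul y y' z
  rw [← h] at h''
  exact h'.symm.trans h''

lemma div_smul_smul {A : Type v} [CommRing A] [Algebra R A] (y y' : B →ₐ[R] A)
    (z : WithConv (H →ₐ[R] A)) : P.smul (P.smul y' (P.div (P.smul y z) y)) z = y' := by
  have h : P.div (P.smul y z) y * z = 1 := P.smul_injective (P.smul y z) (by
    rw [P.smul_mul, P.smul_div, P.smul_one])
  rw [← P.smul_mul, h, P.smul_one]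

end Torsor

/-- A torsor under a smooth group is smooth. -/
theorem Torsor.smooth (P : Torsor R H B) [Algebra.Smooth R H] : Algebra.Smooth R B := by
  have := P.faithfullyFlat
  let e : B ⊗[R] B ≃ₐ[B] B ⊗[R] H :=
    { AlgEquiv.ofBijective (Algebra.TensorProduct.lift
        (Algebra.TensorProduct.includeLeft : B →ₐ[R] B ⊗[R] H) P.coact
          (fun _ _ => Commute.all _ _)) P.bijective with
      commutes' := fun b => by
        change Algebra.TensorProduct.lift
          (Algebra.TensorProduct.includeLeft : B →ₐ[R] B ⊗[R] H) P.coact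
          (fun _ _ => Commute.all _ _) (b ⊗ₜ 1) = b ⊗ₜ 1
        simp }
  -- Base changed to itself the torsor becomes the group, which is smooth; smoothness then descends
  -- along the faithfully flat `R → B`.
  have : Algebra.Smooth B (B ⊗[R] B) := .of_equiv e.symm
  exact Algebra.Smooth.of_smooth_tensorProduct_of_faithfullyFlat B

end Points

/-! ### Frobenius in characteristic `p`, and an integrality criterion -/

section Frobenius

variable {p : ℕ} [hp : Fact p.Prime] {A A' : Type*} [CommRing A] [Algebra ℤ_[p] A] [CommRing A']
  [Algebra ℤ_[p] A']

lemma padic_pow_sub_self_mem (z : ℤ_[p]) : z ^ p - z ∈ Ideal.span {(p : ℤ_[p])} := by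
  rw [← PadicInt.maximalIdeal_eq_span_p, ← PadicInt.ker_toZMod, RingHom.mem_ker, map_sub, map_pow,
    ZMod.pow_card, sub_self]

lemma algebraMap_pow (hA : (p : A) = 0) (z : ℤ_[p]) :
    algebraMap ℤ_[p] A z ^ p = algebraMap ℤ_[p] A z := by
  obtain ⟨c, hc⟩ := Ideal.mem_span_singleton.1 (padic_pow_sub_self_mem z)
  rw [← sub_eq_zero, ← map_pow, ← map_sub, hc, map_mul, map_natCast, hA, zero_mul]

/-- The Frobenius of an algebra over `ℤ_p` that is killed by `p`. -/
def padicFrob (hA : (p : A) = 0) : A →ₐ[ℤ_[p]] A where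
  toFun a := a ^ p
  map_one' := one_pow p
  map_mul' a b := mul_pow a b p
  map_zero' := zero_pow hp.out.ne_zero
  map_add' a b := by
    obtain ⟨r, hr⟩ := exists_add_pow_prime_eq hp.out a b
    rw [hr, hA]
    ring
  commutes' := algebraMap_pow hA

lemma padicFrob_apply (hA : (p : A) = 0) (a : A) : padicFrob hA a = a ^ p := rfl

lemma padicFrob_comp (hA : (p : A) = 0) (hA' : (p : A') = 0) (f : A →ₐ[ℤ_[p]] A') :
    (padicFrob hA').comp f = f.comp (padicFrob hA) := by
  ext a; simp [padicFrob_apply]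

/-- Since `p ≥ 2`, Frobenius kills a square-zero ideal. This is the source of the étaleness of the
Lang map. -/
lemma padicFrob_eq (hA : (p : A) = 0) {I : Ideal A} (hI : I ^ 2 = ⊥) {a b : A} (h : a - b ∈ I) :
    padicFrob hA a = padicFrob hA b := by
  rw [← sub_eq_zero, ← map_sub, padicFrob_apply]
  have : (a - b) ^ p ∈ I ^ 2 := Ideal.pow_le_pow_right hp.out.two_le (Ideal.pow_mem_pow h p)
  rwa [hI] at this

/-- The Frobenius, as a map on the quotient by a square-zero ideal. -/
def padicFrobLift (hA : (p : A) = 0) {I : Ideal A} (hI : I ^ 2 = ⊥) : A ⧸ I →ₐ[ℤ_[p]] A :=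
  Ideal.Quotient.liftₐ I (padicFrob hA) fun a ha =>
    (padicFrob_eq hA hI (by simpa using ha)).trans (map_zero _)

lemma padicFrobLift_comp (hA : (p : A) = 0) {I : Ideal A} (hI : I ^ 2 = ⊥) :
    (padicFrobLift hA hI).comp (Ideal.Quotient.mkₐ ℤ_[p] I) = padicFrob hA := by
  ext a; rfl

lemma comp_padicFrobLift (hA : (p : A) = 0) {I : Ideal A} (hA' : (p : A ⧸ I) = 0)
    (hI : I ^ 2 = ⊥) :
    (Ideal.Quotient.mkₐ ℤ_[p] I).comp (padicFrobLift hA hI) = padicFrob hA' := by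
  refine AlgHom.ext fun a => ?_
  obtain ⟨a, rfl⟩ := Ideal.Quotient.mk_surjective a
  rfl

/-- If the `p`-power iterates of an element stay in a finite module over a noetherian ring, the
element is integral. -/
lemma isIntegral_of_pow_mem {S T : Type*} [CommRing S] [CommRing T] [Algebra S T]
    [IsNoetherianRing S] (q : ℕ) (hq : 1 < q) (x : T) (V : Submodule S T) (hV : V.FG)
    (h : ∀ m : ℕ, x ^ q ^ m ∈ V) : IsIntegral S x := by
  have : Module.Finite S V := Module.Finite.iff_fg.2 hV
  -- The spans of the first `m` iterated powers stabilize by noetherianity.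
  let W : ℕ →o Submodule S V :=
    ⟨fun m => Submodule.span S ((fun j => (⟨x ^ q ^ j, h j⟩ : V)) '' Set.Iio m),
      fun m n hmn => Submodule.span_mono (Set.image_mono (Set.Iio_subset_Iio hmn))⟩
  obtain ⟨n, hn⟩ := monotone_stabilizes_iff_noetherian.2 (inferInstance : IsNoetherian S V) W
  have h1 : (⟨x ^ q ^ n, h n⟩ : V) ∈ W n := by
    rw [hn (n + 1) n.le_succ]
    exact Submodule.subset_span ⟨n, Set.mem_Iio.2 n.lt_succ_self, rfl⟩
  have h2 : x ^ q ^ n ∈ Submodule.span S ((fun j => x ^ q ^ j) '' Set.Iio n) := by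
    have := Submodule.mem_map_of_mem (f := V.subtype) h1
    rw [show W n = Submodule.span S ((fun j => (⟨x ^ q ^ j, h j⟩ : V)) '' Set.Iio n) from rfl,
      Submodule.map_span, Set.image_image] at this
    exact this
  -- As `q > 1`, the exponents `q ^ j` with `j < n` are below `q ^ n`, so the linear relation is a
  -- monic equation for `x`.
  have h3 : ∃ f : Polynomial S, f.degree < (q ^ n : ℕ) ∧ Polynomial.aeval x f = x ^ q ^ n := by
    generalize x ^ q ^ n = w at h2
    induction h2 using Submodule.span_induction with
    | mem y hy =>
      obtain ⟨j, hj, rfl⟩ := hy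
      refine ⟨Polynomial.X ^ q ^ j, lt_of_le_of_lt (Polynomial.degree_X_pow_le _) ?_, by simp⟩
      exact_mod_cast Nat.pow_lt_pow_right hq hj
    | zero => exact ⟨0, by rw [Polynomial.degree_zero]; exact WithBot.bot_lt_coe _, by simp⟩
    | add y z _ _ hy hz =>
      obtain ⟨f, hf, rfl⟩ := hy
      obtain ⟨g, hg, rfl⟩ := hz
      exact ⟨f + g, lt_of_le_of_lt (Polynomial.degree_add_le _ _) (max_lt hf hg), by simp⟩
    | smul a y _ hy =>
      obtain ⟨f, hf, rfl⟩ := hy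
      exact ⟨a • f, lt_of_le_of_lt (Polynomial.degree_smul_le _ _) hf, by simp⟩
  obtain ⟨f, hf, hfx⟩ := h3
  refine ⟨Polynomial.X ^ q ^ n - f, Polynomial.monic_X_pow_sub hf, ?_⟩
  rw [← Polynomial.aeval_def, map_sub, hfx]
  simp

end Frobenius

end KisinTwist
end

noncomputable section

namespace KisinTwist

/-! ### Lang's theorem -/

namespace Lang

variable {p : ℕ} [hp : Fact p.Prime] {H B : Type v} [CommRing H] [HopfAlgebra ℤ_[p] H] [CommRing B]
  [Algebra ℤ_[p] B] (P : Torsor ℤ_[p] H B) (K : Type) [Field K] [Algebra ℤ_[p] K]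

lemma natCast_tensor (hK : (p : K) = 0) (X : Type v) [CommRing X] [Algebra ℤ_[p] X] :
    (p : K ⊗[ℤ_[p]] X) = 0 := by
  rw [← map_natCast (algebraMap K (K ⊗[ℤ_[p]] X)), hK, map_zero]

variable {K} (hK : (p : K) = 0)

/-- The tautological point of a torsor over its special fibre. -/
def point (p : ℕ) [Fact p.Prime] (K : Type) [Field K] [Algebra ℤ_[p] K] (B : Type v) [CommRing B] [Algebra ℤ_[p] B] :
    B →ₐ[ℤ_[p]] K ⊗[ℤ_[p]] B := Algebra.TensorProduct.includeRight

/-- The element of the group by which the Frobenius moves the tautological point. -/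
def shift : WithConv (H →ₐ[ℤ_[p]] K ⊗[ℤ_[p]] B) :=
  P.div (point p K B) ((padicFrob (natCast_tensor K hK B)).comp (point p K B))

/-- The Lang map from the special fibre of the torsor to the special fibre of the group. -/
def langMap : K ⊗[ℤ_[p]] H →ₐ[K] K ⊗[ℤ_[p]] B :=
  Algebra.TensorProduct.lift (Algebra.ofId K _) (shift P hK).ofConv (fun _ _ => Commute.all _ _)

lemma langMap_comp_point :
    ((langMap P hK).restrictScalars ℤ_[p]).comp (point p K H) = (shift P hK).ofConv := by
  ext x
  simp [langMap, point]

/-- If `F(y) = y s`, then `F^m(y) = y · s F(s) ⋯ F^(m-1)(s)`. The product of the translates of `s`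
is the pullback along the Lang map of `c = u F(u) ⋯ F^(m-1)(u)`, with `u` the tautological point of
the group. -/
lemma exists_iterate_frob (m : ℕ) : ∃ c : WithConv (H →ₐ[ℤ_[p]] K ⊗[ℤ_[p]] H),
    ∀ b : B, point p K B b ^ p ^ m = P.smul (point p K B)
      (toConv (((langMap P hK).restrictScalars ℤ_[p]).comp c.ofConv)) b := by
  induction m with
  | zero =>
    refine ⟨1, fun b => ?_⟩
    have : toConv (((langMap P hK).restrictScalars ℤ_[p]).comp
        (1 : WithConv (H →ₐ[ℤ_[p]] K ⊗[ℤ_[p]] H)).ofConv) = 1 := by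
      apply WithConv.ofConv_injective
      ext x
      exact ((langMap P hK).restrictScalars ℤ_[p]).commutes (Coalgebra.counit x)
    rw [this, P.smul_one]
    simp
  | succ m ih =>
    obtain ⟨c, hc⟩ := ih
    have hB := natCast_tensor K hK B
    have hH := natCast_tensor K hK H
    refine ⟨toConv (point p K H) * toConv ((padicFrob hH).comp c.ofConv), fun b => ?_⟩
    have h1 : toConv (((langMap P hK).restrictScalars ℤ_[p]).comp
        (toConv (point p K H) * toConv ((padicFrob hH).comp c.ofConv)).ofConv) =
        shift P hK * toConv ((padicFrob hB).comp
          (((langMap P hK).restrictScalars ℤ_[p]).comp c.ofConv)) := by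
      apply WithConv.ofConv_injective
      rw [ofConv_toConv, AlgHom.comp_convMul_distrib]
      rw [langMap_comp_point, ← AlgHom.comp_assoc, ← AlgHom.comp_assoc, padicFrob_comp hH hB]
    rw [h1, P.smul_mul, shift, P.smul_div, pow_succ, pow_mul, hc]
    have := P.comp_smul (padicFrob hB) (point p K B)
      (toConv (((langMap P hK).restrictScalars ℤ_[p]).comp c.ofConv))
    exact congrArg (fun g => g b) this

/-- The Lang map is integral. -/
lemma langMap_isIntegral [Algebra.FiniteType ℤ_[p] H] :
    (langMap P hK).toRingHom.IsIntegral := by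
  algebraize [(langMap P hK).toRingHom]
  have : IsNoetherianRing (K ⊗[ℤ_[p]] H) := Algebra.FiniteType.isNoetherianRing K _
  suffices h : ∀ x : K ⊗[ℤ_[p]] B, IsIntegral (K ⊗[ℤ_[p]] H) x from h
  have key (b : B) : IsIntegral (K ⊗[ℤ_[p]] H) (point p K B b) := by
    -- The `f i` in the coaction of `b` do not depend on `m`; every `b ^ p ^ m` is a combination of
    -- them with coefficients from the group.
    obtain ⟨k, f, h, hfh⟩ := TensorProduct.exists_sum_tmul_eq (P.coact b)
    refine isIntegral_of_pow_mem p hp.out.one_lt _ (Submodule.span (K ⊗[ℤ_[p]] H)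
      (Set.range fun i => point p K B (f i))) 
        (Submodule.fg_span (Set.finite_range _)) fun m => ?_
    obtain ⟨c, hc⟩ := exists_iterate_frob P hK m
    rw [hc]
    unfold Torsor.smul
    rw [AlgHom.comp_apply, hfh, map_sum]
    refine Submodule.sum_mem _ fun i _ => ?_
    rw [Algebra.TensorProduct.lift_tmul, mul_comm]
    exact Submodule.smul_mem _ (c.ofConv (h i)) (Submodule.subset_span ⟨i, rfl⟩)
  intro x
  induction x with
  | zero => exact isIntegral_zero
  | add x y hx hy => exact hx.add hy
  | tmul k b =>
    have h1 : (k ⊗ₜ[ℤ_[p]] b : K ⊗[ℤ_[p]] B) =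
        algebraMap (K ⊗[ℤ_[p]] H) (K ⊗[ℤ_[p]] B) (k ⊗ₜ 1) * point p K B b := by
      change _ = langMap P hK (k ⊗ₜ 1) * _
      simp [langMap, point, Algebra.ofId_apply]
    rw [h1]
    exact isIntegral_algebraMap.mul (key b)

/-- The Lang map is formally etale. -/
lemma langMap_formallyEtale : (langMap P hK).toRingHom.FormallyEtale := by
  algebraize [(langMap P hK).toRingHom]
  suffices h : Algebra.FormallyEtale (K ⊗[ℤ_[p]] H) (K ⊗[ℤ_[p]] B) from h
  refine Algebra.FormallyEtale.iff_comp_bijective.2 fun S _ _ I hI => ?_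
  let _ : Algebra K S := Algebra.compHom S (algebraMap K (K ⊗[ℤ_[p]] H))
  let _ : Algebra ℤ_[p] S := Algebra.compHom S (algebraMap ℤ_[p] (K ⊗[ℤ_[p]] H))
  have : IsScalarTower K (K ⊗[ℤ_[p]] H) S := .of_algebraMap_eq fun _ => rfl
  have : IsScalarTower ℤ_[p] (K ⊗[ℤ_[p]] H) S := .of_algebraMap_eq fun _ => rfl
  have : IsScalarTower ℤ_[p] (K ⊗[ℤ_[p]] H) (K ⊗[ℤ_[p]] B) := .of_algebraMap_eq fun z =>
    (((langMap P hK).restrictScalars ℤ_[p]).commutes z).symm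
  have : IsScalarTower ℤ_[p] K S := .of_algebraMap_eq fun z => by
    change algebraMap (K ⊗[ℤ_[p]] H) S _ = algebraMap (K ⊗[ℤ_[p]] H) S _
    congr 1
  have hS : (p : S) = 0 := by rw [← map_natCast (algebraMap K S), hK, map_zero]
  have hSI : (p : S ⧸ I) = 0 := by
    rw [← map_natCast (Ideal.Quotient.mk I), hS, map_zero]
  have hB := natCast_tensor K hK B
  -- the given point of the group
  let g (T : Type v) [CommRing T] [Algebra ℤ_[p] T] [Algebra (K ⊗[ℤ_[p]] H) T]
      [IsScalarTower ℤ_[p] (K ⊗[ℤ_[p]] H) T] : WithConv (H →ₐ[ℤ_[p]] T) :=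
    toConv ((IsScalarTower.toAlgHom ℤ_[p] (K ⊗[ℤ_[p]] H) T).comp (point p K H))
  have hg : g (S ⧸ I) = toConv ((Ideal.Quotient.mkₐ ℤ_[p] I).comp (g S).ofConv) := rfl
  -- An algebra map over `K ⊗ H` restricts to a point `y` with `F(y) = y g`, where `g` is the given
  -- point of the group.
  have hfrob (T : Type v) [CommRing T] [Algebra ℤ_[p] T] [Algebra (K ⊗[ℤ_[p]] H) T]
      [IsScalarTower ℤ_[p] (K ⊗[ℤ_[p]] H) T] (hT : (p : T) = 0)
      (ψ : K ⊗[ℤ_[p]] B →ₐ[K ⊗[ℤ_[p]] H] T) :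
      (padicFrob hT).comp ((ψ.restrictScalars ℤ_[p]).comp (point p K B)) =
        P.smul ((ψ.restrictScalars ℤ_[p]).comp (point p K B)) (g T) := by
    rw [← AlgHom.comp_assoc, padicFrob_comp hB, AlgHom.comp_assoc]
    have h1 := P.smul_div (point p K B) ((padicFrob hB).comp (point p K B))
    conv_lhs => rw [← h1]
    rw [P.comp_smul]
    congr 2
    change (ψ.restrictScalars ℤ_[p]).comp (shift P hK).ofConv = _
    rw [← langMap_comp_point, ← AlgHom.comp_assoc]
    congr 1
    exact AlgHom.ext fun x => ψ.commutes x
  constructor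
  -- Two lifts have the same Frobenius, because they agree modulo `I`; cancel `g` in `F(y) = y g`.
  · intro ψ ψ' h
    have h1 : (padicFrob hS).comp ((ψ.restrictScalars ℤ_[p]).comp (point p K B)) =
        (padicFrob hS).comp ((ψ'.restrictScalars ℤ_[p]).comp (point p K B)) := by
      ext b
      refine padicFrob_eq hS hI ?_
      rw [← Ideal.Quotient.eq]
      exact congrArg (fun f => f (point p K B b)) h
    rw [hfrob S hS, hfrob S hS] at h1
    have h2 : (ψ.restrictScalars ℤ_[p]).comp (point p K B) =
        (ψ'.restrictScalars ℤ_[p]).comp (point p K B) := P.smul_right_cancel h1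
    ext x
    induction x with
    | zero => simp
    | add x y hx hy => rw [map_add, map_add, hx, hy]
    | tmul k b =>
      have h3 : (k ⊗ₜ[ℤ_[p]] b : K ⊗[ℤ_[p]] B) =
          algebraMap (K ⊗[ℤ_[p]] H) (K ⊗[ℤ_[p]] B) (k ⊗ₜ 1) * point p K B b := by
        change _ = langMap P hK (k ⊗ₜ 1) * _
        simp [langMap, point, Algebra.ofId_apply]
      rw [h3, map_mul, map_mul, AlgHom.commutes, AlgHom.commutes]
      exact congrArg (fun f => _ * f b) h2
  · intro ψ
    -- Frobenius factors through `S ⧸ I`, so `w` is the Frobenius of any lift, defined without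
    -- having one. The equation then forces the lift to be `y = w g⁻¹`.
    let w : B →ₐ[ℤ_[p]] S := (padicFrobLift hS hI).comp
      ((ψ.restrictScalars ℤ_[p]).comp (point p K B))
    let y : B →ₐ[ℤ_[p]] S := P.smul w (P.div (P.smul w (g S)) w)
    have hw : (Ideal.Quotient.mkₐ ℤ_[p] I).comp w =
        P.smul ((ψ.restrictScalars ℤ_[p]).comp (point p K B)) (g (S ⧸ I)) := by
      rw [← hfrob _ hSI, ← comp_padicFrobLift hS hSI hI, AlgHom.comp_assoc]
    have hy1 : P.smul y (g S) = w := P.div_smul_smul _ _ _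
    have hy2 : (Ideal.Quotient.mkₐ ℤ_[p] I).comp y =
        (ψ.restrictScalars ℤ_[p]).comp (point p K B) := by
      refine P.smul_right_cancel (z := g (S ⧸ I)) ?_
      rw [hg, ← P.comp_smul, hy1, hw, hg]
    have hy3 : (padicFrob hS).comp y = P.smul y (g S) := by
      rw [hy1, ← padicFrobLift_comp hS hI, AlgHom.comp_assoc, hy2]
    let χ : K ⊗[ℤ_[p]] B →ₐ[K] S :=
      Algebra.TensorProduct.lift (Algebra.ofId K S) y (fun _ _ => Commute.all _ _)
    have hχ : (χ.restrictScalars ℤ_[p]).comp (point p K B) = y := by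
      ext b; simp [χ, point]
    -- Linearity over `K ⊗ H`: since `F(y) = y g`, the universal shift specializes to `g` under `χ`.
    have hχg : ∀ x, χ (langMap P hK x) = algebraMap (K ⊗[ℤ_[p]] H) S x := by
      have h1 : (χ.restrictScalars ℤ_[p]).comp (shift P hK).ofConv = (g S).ofConv := by
        have : toConv ((χ.restrictScalars ℤ_[p]).comp (shift P hK).ofConv) = g S := by
          rw [shift, ← P.div_comp, ← AlgHom.comp_assoc, ← padicFrob_comp hB hS, AlgHom.comp_assoc,
            hχ]
          exact P.div_eq hy3.symm
        rw [← this]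
      intro x
      induction x with
      | zero => simp
      | add x y hx hy => simp only [map_add, hx, hy]
      | tmul k h =>
        have h2 : (k ⊗ₜ[ℤ_[p]] h : K ⊗[ℤ_[p]] H) = algebraMap K _ k * point p K H h := by
          simp [point]
        rw [h2, map_mul, map_mul, map_mul, AlgHom.commutes, AlgHom.commutes,
          ← IsScalarTower.algebraMap_apply]
        congr 1
        have h3 := congrArg (fun f => f h) h1
        have h4 := congrArg (fun f => f h) (langMap_comp_point P hK)
        simp only [AlgHom.comp_apply, AlgHom.restrictScalars_apply] at h3 h4
        rw [h4, h3]
        rfl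
    refine ⟨{ χ with commutes' := hχg }, ?_⟩
    ext x
    induction x with
    | zero => simp
    | add x y hx hy => rw [map_add, map_add, hx, hy]
    | tmul k b =>
      have h3 : (k ⊗ₜ[ℤ_[p]] b : K ⊗[ℤ_[p]] B) =
          algebraMap (K ⊗[ℤ_[p]] H) (K ⊗[ℤ_[p]] B) (k ⊗ₜ 1) * point p K B b := by
        change _ = langMap P hK (k ⊗ₜ 1) * _
        simp [langMap, point, Algebra.ofId_apply]
      rw [h3, map_mul, map_mul, AlgHom.commutes, AlgHom.commutes]
      congr 1
      rw [← hχ] at hy2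
      exact congrArg (fun f => f b) hy2

/-- The Lang map is surjective on spectra, if the special fibre of the group is connected. -/
lemma langMap_surjective [Algebra.FiniteType ℤ_[p] H] [Algebra.FiniteType ℤ_[p] B]
    [Nontrivial (K ⊗[ℤ_[p]] B)] [ConnectedSpace (PrimeSpectrum (K ⊗[ℤ_[p]] H))] :
    Function.Surjective (PrimeSpectrum.comap (langMap P hK).toRingHom) := by
  have hint := langMap_isIntegral P hK
  have het := langMap_formallyEtale P hK
  algebraize [(langMap P hK).toRingHom]
  have : IsScalarTower K (K ⊗[ℤ_[p]] H) (K ⊗[ℤ_[p]] B) := .of_algebraMap_eq fun z =>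
    ((langMap P hK).commutes z).symm
  have : IsNoetherianRing (K ⊗[ℤ_[p]] H) := Algebra.FiniteType.isNoetherianRing K _
  have : Algebra.FiniteType (K ⊗[ℤ_[p]] H) (K ⊗[ℤ_[p]] B) :=
    Algebra.FiniteType.of_restrictScalars_finiteType K _ _
  have : Algebra.FinitePresentation (K ⊗[ℤ_[p]] H) (K ⊗[ℤ_[p]] B) :=
    Algebra.FinitePresentation.of_finiteType.1 inferInstance
  have : Algebra.Etale (K ⊗[ℤ_[p]] H) (K ⊗[ℤ_[p]] B) := {}
  -- Integral maps are closed; étale maps are flat of finite presentation, hence open.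
  have h1 : IsClopen (Set.range (PrimeSpectrum.comap (langMap P hK).toRingHom)) :=
    ⟨(PrimeSpectrum.isClosedMap_comap_of_isIntegral _ hint).isClosed_range,
      (PrimeSpectrum.isOpenMap_comap_of_hasGoingDown_of_finitePresentation
        (R := K ⊗[ℤ_[p]] H) (S := K ⊗[ℤ_[p]] B)).isOpen_range⟩
  exact Set.range_eq_univ.1 (h1.eq_univ (Set.range_nonempty _))

/-- Elements of a field of characteristic `p` that are fixed by the Frobenius lie in the prime
field. -/
lemma mem_range_of_pow_eq {L : Type*} [Field L] [Algebra ℤ_[p] L] (hL : (p : L) = 0) {x : L}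
    (hx : x ^ p = x) : ∃ z : ℤ_[p], algebraMap ℤ_[p] L z = x := by
  have : CharP L p := (CharP.charP_iff_prime_eq_zero hp.out).2 hL
  rw [← Subfield.mem_bot_iff_pow_eq_self, ← ZMod.fieldRange_castHom_eq_bot p] at hx
  obtain ⟨c, rfl⟩ := hx
  refine ⟨(c.val : ℤ_[p]), ?_⟩
  rw [map_natCast, ZMod.castHom_apply, ZMod.natCast_val]

/-- **Lang's theorem**: a torsor has a rational point over the residue field `F_p` of `ℤ_p`, if
the special fibre of the group is connected. -/
theorem exists_point_residueField (P : Torsor ℤ_[p] H B) [Algebra.FiniteType ℤ_[p] H] [Algebra.FiniteType ℤ_[p] B]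
    [ConnectedSpace (PrimeSpectrum (K ⊗[ℤ_[p]] H))] (hK : (p : K) = 0) :
    Nonempty (B →ₐ[ℤ_[p]] ℤ_[p] ⧸ IsLocalRing.maximalIdeal ℤ_[p]) := by
  have := P.faithfullyFlat
  have : Nontrivial (K ⊗[ℤ_[p]] B) := inferInstance
  have hB := natCast_tensor K hK B
  -- The identity section of the special fibre; `Q` will be a point of the torsor above it.
  let ε : K ⊗[ℤ_[p]] H →ₐ[K] K := Algebra.TensorProduct.lift (AlgHom.id K K)
    ((Algebra.ofId ℤ_[p] K).comp (Bialgebra.counitAlgHom ℤ_[p] H)) (fun _ _ => Commute.all _ _)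
  obtain ⟨Q, hQ⟩ := langMap_surjective P hK ⟨RingHom.ker ε, RingHom.ker_isPrime _⟩
  let L := Q.asIdeal.ResidueField
  have hL : (p : L) = 0 := by rw [← map_natCast (algebraMap (K ⊗[ℤ_[p]] B) L), hB, map_zero]
  let r : K ⊗[ℤ_[p]] B →ₐ[ℤ_[p]] L := IsScalarTower.toAlgHom ℤ_[p] (K ⊗[ℤ_[p]] B) L
  have hr (x : H) : r ((shift P hK).ofConv x) = algebraMap ℤ_[p] L (Coalgebra.counit x) := by
    have h1 : point p K H x - algebraMap ℤ_[p] _ (Coalgebra.counit x) ∈ RingHom.ker ε := by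
      rw [RingHom.mem_ker, map_sub, sub_eq_zero]
      exact Eq.trans (by simp [ε, point, Algebra.ofId_apply])
        ((ε.restrictScalars ℤ_[p]).commutes _).symm
    have h2 : RingHom.ker ε = Q.asIdeal.comap (langMap P hK).toRingHom :=
      (congrArg PrimeSpectrum.asIdeal hQ).symm
    rw [h2, Ideal.mem_comap] at h1
    have h3 : r (((langMap P hK).restrictScalars ℤ_[p])
        (point p K H x - algebraMap ℤ_[p] _ (Coalgebra.counit x))) = 0 :=
      Ideal.algebraMap_residueField_eq_zero.2 h1
    rw [map_sub, AlgHom.commutes, map_sub, AlgHom.commutes, sub_eq_zero] at h3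
    rw [← h3, ← langMap_comp_point]
    rfl
  let y : B →ₐ[ℤ_[p]] L := r.comp (point p K B)
  -- Above the identity the shift is trivial, so Frobenius fixes the point and its coordinates lie
  -- in the prime field.
  have hy : (padicFrob hL).comp y = y := by
    have h1 : toConv (r.comp (shift P hK).ofConv) = 1 := by
      apply WithConv.ofConv_injective
      exact AlgHom.ext hr
    have h2 := P.comp_smul r (point p K B) (shift P hK)
    rw [h1, P.smul_one, shift, P.smul_div, ← AlgHom.comp_assoc, ← padicFrob_comp hB hL] at h2
    exact (AlgHom.comp_assoc _ _ _).symm.trans h2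
  have hker : ∀ z ∈ IsLocalRing.maximalIdeal ℤ_[p], Algebra.ofId ℤ_[p] L z = 0 := fun z hz => by
    rw [PadicInt.maximalIdeal_eq_span_p] at hz
    obtain ⟨c, rfl⟩ := Ideal.mem_span_singleton.1 hz
    rw [map_mul, map_natCast, hL, zero_mul]
  let j : ℤ_[p] ⧸ IsLocalRing.maximalIdeal ℤ_[p] →ₐ[ℤ_[p]] L :=
    Ideal.Quotient.liftₐ _ (Algebra.ofId ℤ_[p] L) hker
  have hj : Function.Injective j := by
    let _ : Field (ℤ_[p] ⧸ IsLocalRing.maximalIdeal ℤ_[p]) := Ideal.Quotient.field _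
    exact j.toRingHom.injective
  have hyj (b : B) : y b ∈ j.range := by
    obtain ⟨z, hz⟩ := mem_range_of_pow_eq hL (congrArg (fun f => f b) hy)
    exact ⟨Ideal.Quotient.mk _ z, hz⟩
  exact ⟨(AlgEquiv.ofInjective j hj).symm.toAlgHom.comp (y.codRestrict j.range hyj)⟩

end Lang

/-- A torsor under a smooth affine group scheme over `ℤ_p` with connected special fibre is
trivial. -/
theorem Torsor.exists_point {p : ℕ} [Fact p.Prime] {H B : Type v} [CommRing H]
    [HopfAlgebra ℤ_[p] H] [CommRing B] [Algebra ℤ_[p] B] (P : Torsor ℤ_[p] H B)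
    [Algebra.Smooth ℤ_[p] H] {q : Ideal ℤ_[p]} [q.IsPrime] (hq : (p : ℤ_[p]) ∈ q)
    [ConnectedSpace (PrimeSpectrum (q.Fiber H))] : Nonempty (B →ₐ[ℤ_[p]] ℤ_[p]) := by
  have := P.smooth
  have hK : (p : q.ResidueField) = 0 := by
    rw [← map_natCast (algebraMap ℤ_[p] q.ResidueField)]
    exact Ideal.algebraMap_residueField_eq_zero.2 hq
  obtain ⟨f⟩ := Lang.exists_point_residueField P hK
  -- Formal smoothness lifts the `F_p`-point successively modulo powers of `p`, and `ℤ_p` is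
  -- complete.
  obtain ⟨g, -⟩ := Algebra.FormallySmooth.exists_mkₐ_comp_eq_of_isAdicComplete f
  exact ⟨g⟩

end KisinTwist
end

noncomputable section

namespace KisinTwist

/-! ### Group objects and their points -/

section GroupObjects

variable {C : Type u} [Category.{v} C] [CartesianMonoidalCategory C] [BraidedCategory C]

/-- The commutative group object given by a representable presheaf of commutative groups. -/
def commGrpOfRepresentableBy (F : Cᵒᵖ ⥤ CommGrpCat.{v}) {X : C}
    (α : (F ⋙ forget _).RepresentableBy X) : CommGrp C :=
  letI := CommGrpObj.ofRepresentableBy X F α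
  ⟨X⟩

/-- The points of a commutative group object given by a representable presheaf. -/
def commGrpOfRepresentableByEquiv (F : Cᵒᵖ ⥤ CommGrpCat.{v}) {X : C}
    (α : (F ⋙ forget _).RepresentableBy X) (T : C) :
    (T ⟶ (commGrpOfRepresentableBy F α).X) ≃* F.obj (Opposite.op T) where
  toEquiv := α.homEquiv
  map_mul' f g := by
    let := CommGrpObj.ofRepresentableBy X F α
    let α' : ((F ⋙ forget₂ CommGrpCat GrpCat ⋙ forget₂ GrpCat MonCat) ⋙ forget _).RepresentableBy X := α
    exact map_mul ((yonedaMonObjIsoOfRepresentableBy X (F ⋙ forget₂ CommGrpCat GrpCat ⋙ forget₂ GrpCat MonCat) α').hom.app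
      (Opposite.op T)).hom f g

/-- A natural homomorphism on points comes from a homomorphism of group objects. -/
def commGrpHomOfPoints {G G' : CommGrp C} (f : ∀ T : C, (T ⟶ G.X) →* (T ⟶ G'.X))
    (hf : ∀ (T T' : C) (g : T' ⟶ T) (x : T ⟶ G.X), f T' (g ≫ x) = g ≫ f T x) : G ⟶ G' :=
  InducedCategory.homMk (Grp.homMk'' (f G.X (𝟙 G.X))
    (by
      rw [← hf, Category.comp_id, MonObj.one_eq_one, map_one, MonObj.one_eq_one])
    (by
      rw [← hf, Category.comp_id, MonObj.mul_eq_mul, map_mul, MonObj.mul_eq_mul, MonObj.comp_mul]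
      congr 1
      · rw [CartesianMonoidalCategory.tensorHom_fst, ← hf, Category.comp_id]
      · rw [CartesianMonoidalCategory.tensorHom_snd, ← hf, Category.comp_id]))

lemma comp_commGrpHomOfPoints {G G' : CommGrp C} (f : ∀ T : C, (T ⟶ G.X) →* (T ⟶ G'.X))
    (hf : ∀ (T T' : C) (g : T' ⟶ T) (x : T ⟶ G.X), f T' (g ≫ x) = g ≫ f T x) {T : C}
    (x : T ⟶ G.X) : x ≫ (commGrpHomOfPoints f hf).hom.hom.hom = f T x := by
  have := hf G.X T x (𝟙 G.X)
  rw [Category.comp_id] at this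
  exact this.symm

end GroupObjects

/-! ### Finite locally free schemes over a base -/

/-- `X` is finite, flat and of finite presentation over the base. -/
structure IsFinFlat {S : Scheme.{u}} (X : Over S) : Prop where
  finite : IsFinite X.hom
  flat : Flat X.hom
  locallyOfFinitePresentation : LocallyOfFinitePresentation X.hom

section FinFlat

open MonoidalCategory SemiCartesianMonoidalCategory CartesianMonoidalCategory

variable {S : Scheme.{u}}

lemma isFinFlat_unit : IsFinFlat (𝟙_ (Over S)) where
  finite := inferInstanceAs (IsFinite (𝟙 S))
  flat := inferInstanceAs (Flat (𝟙 S))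
  locallyOfFinitePresentation := inferInstanceAs (LocallyOfFinitePresentation (𝟙 S))

lemma IsFinFlat.tensor {X Y : Over S} (hX : IsFinFlat X) (hY : IsFinFlat Y) :
    IsFinFlat (X ⊗ Y) := by
  obtain ⟨h1, h2, h3⟩ := hX
  obtain ⟨h4, h5, h6⟩ := hY
  constructor <;> rw [Over.tensorObj_hom] <;> infer_instance

lemma IsFinFlat.exists_power {X : Over S} (hX : IsFinFlat X) (k : ℕ) :
    ∃ (Y : Over S) (pr : Fin k → (Y ⟶ X)), IsFinFlat Y ∧
      ∀ (T : Over S) (x : Fin k → (T ⟶ X)), ∃! f : T ⟶ Y, ∀ i, f ≫ pr i = x i := by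
  induction k with
  | zero =>
    exact ⟨𝟙_ _, fun i => i.elim0, isFinFlat_unit, fun T x =>
      ⟨toUnit T, fun i => i.elim0, fun f _ => toUnit_unique _ _⟩⟩
  | succ k ih =>
    obtain ⟨Y, pr, hY, h⟩ := ih
    refine ⟨X ⊗ Y, Fin.cons (fst X Y) fun i => snd X Y ≫ pr i, hX.tensor hY, fun T x => ?_⟩
    obtain ⟨f, hf, hf'⟩ := h T fun i => x i.succ
    refine ⟨lift (x 0) f, fun i => ?_, fun g hg => ?_⟩
    · refine Fin.cases ?_ (fun i => ?_) i
      · simp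
      · simpa using hf i
    · have h0 : g ≫ fst X Y = x 0 := hg 0
      have h1 : g ≫ snd X Y = f := hf' _ fun i => by simpa using hg i.succ
      ext1
      · rw [h0, lift_fst]
      · rw [h1, lift_snd]

/-- A property of morphisms that is stable under retracts of rings passes to retracts of
affine morphisms. -/
lemma of_retract_of_isAffineHom {W : MorphismProperty Scheme.{u}}
    {Q : ∀ {R S : Type u} [CommRing R] [CommRing S], (R →+* S) → Prop} [HasRingHomProperty W Q]
    [W.IsStableUnderBaseChange]
    (hQ : ∀ {A C D : Type u} [CommRing A] [CommRing C] [CommRing D] (f : A →+* C) (s : C →+* D)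
      (t : D →+* C), t.comp s = RingHom.id C → Q (s.comp f) → Q f)
    {X Y S : Scheme.{u}} {g : X ⟶ S} {h : Y ⟶ S} {i : X ⟶ Y} {r : Y ⟶ X} (hir : i ≫ r = 𝟙 X)
    (hrg : r ≫ g = h) [IsAffineHom g] [IsAffineHom h] (H : W h) : W g := by
  -- The property is local on the target, and base change preserves the retraction.
  wlog hS : IsAffine S generalizing X Y S
  · refine IsZariskiLocalAtTarget.of_openCover (P := W) S.affineCover fun j => ?_
    have hig : i ≫ h = g := by rw [← hrg, reassoc_of% hir]
    exact this (g := Limits.pullback.snd g (S.affineCover.f j))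
      (h := Limits.pullback.snd h (S.affineCover.f j))
      (i := Limits.pullback.map _ _ _ _ i (𝟙 _) (𝟙 _) (by simp [hig]) (by simp))
      (r := Limits.pullback.map _ _ _ _ r (𝟙 _) (𝟙 _) (by simp [hrg]) (by simp))
      (by
        apply Limits.pullback.hom_ext
        · rw [Category.assoc, Limits.pullback.lift_fst, Limits.pullback.lift_fst_assoc,
            Category.assoc, hir, Category.comp_id, Category.id_comp]
        · rw [Category.assoc, Limits.pullback.lift_snd, Limits.pullback.lift_snd_assoc,
            Category.assoc, Category.comp_id, Category.comp_id, Category.id_comp])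
      (by rw [Limits.pullback.lift_snd, Category.comp_id]) (W.pullback_snd _ _ H) inferInstance
  have : IsAffine X := isAffine_of_isAffineHom g
  have : IsAffine Y := isAffine_of_isAffineHom h
  rw [HasRingHomProperty.iff_of_isAffine (P := W)] at H ⊢
  refine hQ g.appTop.hom r.appTop.hom i.appTop.hom ?_ ?_
  · rw [← CommRingCat.hom_comp, ← Scheme.Hom.comp_appTop, hir]
    simp
  · rwa [← CommRingCat.hom_comp, ← Scheme.Hom.comp_appTop, hrg]

lemma IsFinFlat.of_retract {X Y : Over S} (hY : IsFinFlat Y) {i : X ⟶ Y} {r : Y ⟶ X}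
    (hir : i ≫ r = 𝟙 X) : IsFinFlat X := by
  obtain ⟨h1, h2, h3⟩ := hY
  have hir' : i.left ≫ r.left = 𝟙 X.left := by rw [← Over.comp_left, hir, Over.id_left]
  have hrX : r.left ≫ X.hom = Y.hom := Over.w r
  have hiY : i.left ≫ Y.hom = X.hom := Over.w i
  have : IsSeparated (r.left ≫ X.hom) := by rw [hrX]; infer_instance
  have : IsSeparated r.left := .of_comp r.left X.hom
  -- A section of a separated morphism is a closed immersion, so `X` is finite over `S` because `Y`
  -- is.
  have : IsClosedImmersion (i.left ≫ r.left) := by rw [hir']; infer_instance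
  have : IsClosedImmersion i.left := .of_comp i.left r.left
  have hfin : IsFinite X.hom := by rw [← hiY]; infer_instance
  refine ⟨hfin, ?_, ?_⟩
  · refine of_retract_of_isAffineHom (W := @Flat) ?_ hir' hrX h2
    intro A C D _ _ _ f s t hst hf
    algebraize [f, s, s.comp f]
    have : Module.Flat A D := hf
    -- `C` is a retract of `D` as an `A`-module: `t` is `A`-linear because `t (s (f a)) = f a`.
    have : Module.Flat A C := Module.Flat.of_retract (M := D)
      (IsScalarTower.toAlgHom A C D).toLinearMap
      { t with
        map_smul' := fun a d => by
          have h1 : t (s (f a)) = f a := congrArg (fun g => g (f a)) hst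
          change t (a • d) = a • t d
          rw [Algebra.smul_def, Algebra.smul_def, map_mul]
          congr 1 } (LinearMap.ext fun c => congrArg (fun g => g c) hst)
    exact this
  · refine of_retract_of_isAffineHom (W := @LocallyOfFinitePresentation) ?_ hir' hrX h3
    intro A C D _ _ _ f s t hst hf
    -- `t` has the section `s` of finite type, so it is of finite presentation, and `f = t ∘ s ∘ f`
    -- is the composite of `t` with a map of finite presentation.
    have hs : s.FiniteType :=
      RingHom.FiniteType.of_comp_finiteType (f := f) (RingHom.FiniteType.of_finitePresentation hf)
    have ht : t.FinitePresentation := RingHom.FinitePresentation.of_comp_finiteType s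
      (by rw [hst]; exact .id _) hs
    have := ht.comp hf
    rwa [← RingHom.comp_assoc, hst, RingHom.id_comp] at this

/-- Equalizers exist over `S`, so idempotents split, and the image is a retract of `Y`. -/
lemma IsFinFlat.exists_splitting {Y : Over S} (hY : IsFinFlat Y) (e : Y ⟶ Y) (he : e ≫ e = e) :
    ∃ (X : Over S) (i : X ⟶ Y) (r : Y ⟶ X), IsFinFlat X ∧ i ≫ r = 𝟙 X ∧ r ≫ i = e := by
  have : IsIdempotentComplete (Over S) :=
    Idempotents.isIdempotentComplete_iff_hasEqualizer_of_id_and_idempotent _ |>.2 fun _ _ _ =>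
      inferInstance
  obtain ⟨X, i, r, h1, h2⟩ := IsIdempotentComplete.idempotents_split Y e he
  exact ⟨X, i, r, hY.of_retract h1, h1, h2⟩

end FinFlat

end KisinTwist
end

noncomputable section

namespace KisinTwist

variable {p : ℕ} [Fact p.Prime]

namespace PDivGroup

variable {S : Scheme.{u}} (D : PDivGroup p S)

/-! ### Points of a `p`-divisible group -/

lemma isFinFlat (n : ℕ) : IsFinFlat (D.G.obj n).X :=
  ⟨D.finite n, D.flat n, D.locallyOfFinitePresentation n⟩

lemma res_id (n : ℕ) (T : Over S) (x : D.Pts n T) : D.res n (𝟙 T) x = x :=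
  Category.id_comp x.hom

lemma res_comp (n : ℕ) {T T' T'' : Over S} (f : T' ⟶ T) (g : T'' ⟶ T') (x : D.Pts n T) :
    D.res n (g ≫ f) x = D.res n g (D.res n f x) :=
  Category.assoc g f x.hom

lemma res_incl (n : ℕ) {T T' : Over S} (f : T' ⟶ T) (x : D.Pts n T) :
    D.res (n + 1) f (D.incl n T x) = D.incl n T' (D.res n f x) :=
  (Category.assoc f x.hom _).symm

lemma incl_inj (n : ℕ) (T : Over S) : Function.Injective (D.incl n T) :=
  D.incl_injective n T

lemma nsmul_eq_zero_iff (n : ℕ) (T : Over S) (y : D.Pts (n + 1) T) :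
    p ^ n • y = 0 ↔ ∃ x, D.incl n T x = y :=
  D.torsion n T y.hom

/-- A morphism of `S`-schemes that is an fppf covering. -/
structure IsFppfCover {T T' : Over S} (f : T' ⟶ T) : Prop where
  flat : Flat f.left
  surjective : Surjective f.left
  locallyOfFinitePresentation : LocallyOfFinitePresentation f.left

lemma IsFppfCover.id (T : Over S) : IsFppfCover (𝟙 T) := by
  constructor <;> rw [Over.id_left] <;> infer_instance

lemma IsFppfCover.comp {T T' T'' : Over S} {f : T' ⟶ T} {g : T'' ⟶ T'} (hf : IsFppfCover f)
    (hg : IsFppfCover g) : IsFppfCover (g ≫ f) := by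
  obtain ⟨h1, h2, h3⟩ := hf
  obtain ⟨h4, h5, h6⟩ := hg
  constructor <;> rw [Over.comp_left] <;> infer_instance

lemma exists_divisible (n : ℕ) {T : Over S} (x : D.Pts n T) : ∃ (T' : Over S) (f : T' ⟶ T),
    IsFppfCover f ∧ ∃ y : D.Pts (n + 1) T', p • y = D.incl n T' (D.res n f x) := by
  obtain ⟨T', f, h1, h2, h3, y, hy⟩ := D.divisible n T x.hom
  exact ⟨T', f, ⟨h1, h2, h3⟩, toPts y, hy.trans (Category.assoc _ _ _).symm⟩

/-- Refine the covering one coordinate at a time. -/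
lemma exists_divisible_pi (n : ℕ) {T : Over S} {k : ℕ} (x : Fin k → D.Pts n T) :
    ∃ (T' : Over S) (f : T' ⟶ T), IsFppfCover f ∧
      ∃ y : Fin k → D.Pts (n + 1) T', ∀ i, p • y i = D.incl n T' (D.res n f (x i)) := by
  classical
  suffices h : ∀ s : Finset (Fin k), ∃ (T' : Over S) (f : T' ⟶ T), IsFppfCover f ∧
      ∀ i ∈ s, ∃ y : D.Pts (n + 1) T', p • y = D.incl n T' (D.res n f (x i)) by
    obtain ⟨T', f, hf, h⟩ := h Finset.univ
    choose y hy using fun i => h i (Finset.mem_univ i)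
    exact ⟨T', f, hf, y, hy⟩
  intro s
  induction s using Finset.induction_on with
  | empty => exact ⟨T, 𝟙 T, .id T, by simp⟩
  | insert a s ha ih =>
    obtain ⟨T', f, hf, h⟩ := ih
    obtain ⟨T'', g, hg, z, hz⟩ := D.exists_divisible n (D.res n f (x a))
    refine ⟨T'', g ≫ f, hf.comp hg, fun i hi => ?_⟩
    rw [res_comp]
    obtain rfl | hi := Finset.mem_insert.1 hi
    · exact ⟨z, hz⟩
    · obtain ⟨y, hy⟩ := h i hi
      exact ⟨D.res (n + 1) g y, by rw [← map_nsmul, hy, res_incl]⟩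

/-! ### Splitting idempotents on powers of a `p`-divisible group -/

/-- An idempotent endomorphism of `D^k`, given by its action on points. -/
structure PowIdempotent (k : ℕ) where
  map : ∀ (n : ℕ) (T : Over S), (Fin k → D.Pts n T) →+ (Fin k → D.Pts n T)
  idem : ∀ n T v, map n T (map n T v) = map n T v
  map_res : ∀ (n : ℕ) {T T' : Over S} (f : T' ⟶ T) (v : Fin k → D.Pts n T) (i : Fin k),
    map n T' (fun i => D.res n f (v i)) i = D.res n f (map n T v i)
  map_incl : ∀ (n : ℕ) (T : Over S) (v : Fin k → D.Pts n T) (i : Fin k),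
    map (n + 1) T (fun i => D.incl n T (v i)) i = D.incl n T (map n T v i)

namespace PowIdempotent

variable {D} {k : ℕ} (e : D.PowIdempotent k)

/-- The fixed points of an idempotent. -/
def fixed (n : ℕ) (T : Over S) : AddSubgroup (Fin k → D.Pts n T) where
  carrier := {v | e.map n T v = v}
  zero_mem' := map_zero _
  add_mem' {v w} hv hw := by
    rw [Set.mem_ofPred_eq] at hv hw ⊢
    rw [map_add, hv, hw]
  neg_mem' {v} hv := by
    rw [Set.mem_ofPred_eq] at hv ⊢
    rw [map_neg, hv]

lemma mem_fixed {n : ℕ} {T : Over S} {v : Fin k → D.Pts n T} :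
    v ∈ e.fixed n T ↔ e.map n T v = v := Iff.rfl

/-- Restriction of fixed points. -/
def fixedRes (n : ℕ) {T T' : Over S} (f : T' ⟶ T) : e.fixed n T →+ e.fixed n T' where
  toFun v := ⟨fun i => D.res n f (v.1 i), by
    rw [mem_fixed]
    funext i
    rw [e.map_res, e.mem_fixed.1 v.2]⟩
  map_zero' := by ext i; exact map_zero _
  map_add' v w := by ext i; exact map_add _ _ _

/-- Inclusion of fixed points into the next level. -/
def fixedIncl (n : ℕ) (T : Over S) : e.fixed n T →+ e.fixed (n + 1) T where
  toFun v := ⟨fun i => D.incl n T (v.1 i), by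
    rw [mem_fixed]
    funext i
    rw [e.map_incl, e.mem_fixed.1 v.2]⟩
  map_zero' := by ext i; exact map_zero _
  map_add' v w := by ext i; exact map_add _ _ _

/-- The presheaf of fixed points of an idempotent. -/
def presheaf (n : ℕ) : (Over S)ᵒᵖ ⥤ CommGrpCat.{u} where
  obj T := CommGrpCat.of (Multiplicative (e.fixed n T.unop))
  map f := CommGrpCat.ofHom (AddMonoidHom.toMultiplicative (e.fixedRes n f.unop))
  map_id T := by
    ext v
    exact congrArg Multiplicative.ofAdd (Subtype.ext (funext fun i => D.res_id n _ _))
  map_comp f g := by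
    ext v
    exact congrArg Multiplicative.ofAdd (Subtype.ext (funext fun i => D.res_comp n _ _ _))

/-- By Yoneda the idempotent on points is an idempotent endomorphism of the `k`-fold power of
`D[p^n]`; its image represents the fixed points. -/
lemma exists_representableBy (n : ℕ) : ∃ X : Over S, IsFinFlat X ∧
    Nonempty ((e.presheaf n ⋙ forget _).RepresentableBy X) := by
  obtain ⟨Y, pr, hY, h⟩ := (D.isFinFlat n).exists_power k
  choose l hl hl' using h
  let pt : Fin k → D.Pts n Y := fun i => toPts (pr i)
  -- The idempotent applied to the universal point of the power.
  let π : Y ⟶ Y := l Y fun i => (e.map n Y pt i).hom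
  have hpt {T : Over S} (f : T ⟶ Y) :
      (fun i => D.res n f (pt i)) = fun i => toPts (f ≫ pr i) := rfl
  have hπ {T : Over S} (f : T ⟶ Y) (i : Fin k) : f ≫ π ≫ pr i =
      (e.map n T (fun i => toPts (f ≫ pr i)) i).hom := by
    rw [hl]
    exact (e.map_res n f pt i).symm
  have hY' {T : Over S} {f g : T ⟶ Y} (hfg : ∀ i, f ≫ pr i = g ≫ pr i) : f = g :=
    (hl' T _ f hfg).trans (hl' T _ g fun _ => rfl).symm
  have hππ : π ≫ π = π := hY' fun i => by
    rw [Category.assoc, hπ]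
    have h1 : (fun i => (toPts (π ≫ pr i) : D.Pts n Y)) = e.map n Y pt := funext fun i => hl _ _ i
    rw [h1, e.idem]
    exact (hl _ _ i).symm
  obtain ⟨X, i, r, hX, hir, hri⟩ := hY.exists_splitting π hππ
  have hi : i ≫ π = i := by rw [← hri, reassoc_of% hir]
  refine ⟨X, hX, ⟨{ homEquiv := fun {T} => ?_, homEquiv_comp := ?_ }⟩⟩
  · refine ⟨fun f => Multiplicative.ofAdd ⟨fun j => toPts (f ≫ i ≫ pr j), ?_⟩,
      fun v => l T (fun j => ((Multiplicative.toAdd v).1 j).hom) ≫ r, fun f => ?_, fun v => ?_⟩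
    · rw [mem_fixed]
      funext j
      have := hπ (f ≫ i) j
      simp only [Category.assoc] at this
      rw [reassoc_of% hi] at this
      exact this.symm
    · have : l T (fun j => f ≫ i ≫ pr j) = f ≫ i := hY' fun j => by rw [hl, Category.assoc]
      change l T (fun j => f ≫ i ≫ pr j) ≫ r = f
      rw [this, Category.assoc, hir, Category.comp_id]
    · refine congrArg Multiplicative.ofAdd (Subtype.ext (funext fun j => ?_))
      change (toPts ((l T (fun j => ((Multiplicative.toAdd v).1 j).hom) ≫ r) ≫ i ≫ pr j) :
        D.Pts n T) = (Multiplicative.toAdd v).1 j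
      have h1 := hπ (l T fun j => ((Multiplicative.toAdd v).1 j).hom) j
      rw [← hri, Category.assoc, ← Category.assoc] at h1
      rw [h1]
      have h2 : (fun j => (toPts (l T (fun j => ((Multiplicative.toAdd v).1 j).hom) ≫ pr j) :
          D.Pts n T)) = (Multiplicative.toAdd v).1 := funext fun j => hl _ _ j
      rw [h2]
      exact congrFun (Multiplicative.toAdd v).2 j
  · intro T T' f g
    exact congrArg Multiplicative.ofAdd (Subtype.ext (funext fun j => congrArg toPts
      (Category.assoc f g (i ≫ pr j))))

/-- The scheme of fixed points of an idempotent. -/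
def scheme (n : ℕ) : Over S := (e.exists_representableBy n).choose

lemma scheme_isFinFlat (n : ℕ) : IsFinFlat (e.scheme n) :=
  (e.exists_representableBy n).choose_spec.1

/-- The group scheme of fixed points of an idempotent. -/
def grp (n : ℕ) : CommGrp (Over S) :=
  commGrpOfRepresentableBy (e.presheaf n) (e.exists_representableBy n).choose_spec.2.some

/-- The points of the scheme of fixed points. -/
def ptsEquiv (n : ℕ) (T : Over S) : Additive (T ⟶ (e.grp n).X) ≃+ e.fixed n T :=
  MulEquiv.toAdditiveLeft (commGrpOfRepresentableByEquiv (e.presheaf n)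
    (e.exists_representableBy n).choose_spec.2.some T)

lemma ptsEquiv_res (n : ℕ) {T T' : Over S} (f : T' ⟶ T) (x : T ⟶ (e.grp n).X) :
    e.ptsEquiv n T' (Additive.ofMul (f ≫ x)) =
      e.fixedRes n f (e.ptsEquiv n T (Additive.ofMul x)) :=
  (e.exists_representableBy n).choose_spec.2.some.homEquiv_comp f x

lemma fixedIncl_fixedRes (n : ℕ) {T T' : Over S} (f : T' ⟶ T) (v : e.fixed n T) :
    e.fixedIncl n T' (e.fixedRes n f v) = e.fixedRes (n + 1) f (e.fixedIncl n T v) :=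
  Subtype.ext (funext fun _ => (D.res_incl n f _).symm)

lemma fixedIncl_injective (n : ℕ) (T : Over S) : Function.Injective (e.fixedIncl n T) :=
  fun _ _ h => Subtype.ext (funext fun i => D.incl_inj n T (congrFun (congrArg Subtype.val h) i))

/-- The preimages of the coordinates exist by torsion in `D`; they form a fixed point because the
inclusion is injective and commutes with the idempotent. -/
lemma nsmul_eq_zero_iff (n : ℕ) (T : Over S) (y : e.fixed (n + 1) T) :
    p ^ n • y = 0 ↔ ∃ x, e.fixedIncl n T x = y := by
  constructor
  · intro h
    choose v hv using fun i => (D.nsmul_eq_zero_iff n T (y.1 i)).1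
      (congrFun (congrArg Subtype.val h) i)
    refine ⟨⟨v, ?_⟩, Subtype.ext (funext hv)⟩
    rw [mem_fixed]
    funext i
    apply D.incl_inj n T
    rw [← e.map_incl, funext hv, e.mem_fixed.1 y.2, hv]
  · rintro ⟨x, rfl⟩
    rw [← map_nsmul]
    exact (congrArg _ (Subtype.ext (funext fun i => D.pow_nsmul_eq_zero _))).trans (map_zero _)

/-- Divide the coordinates by `p` in `D` after a covering, then apply the idempotent: it is additive
and fixes `x`. -/
lemma exists_nsmul_eq (n : ℕ) {T : Over S} (x : e.fixed n T) : ∃ (T' : Over S) (f : T' ⟶ T),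
    IsFppfCover f ∧ ∃ y, p • y = e.fixedRes (n + 1) f (e.fixedIncl n T x) := by
  obtain ⟨T', f, hf, y, hy⟩ := D.exists_divisible_pi n x.1
  refine ⟨T', f, hf, ⟨e.map (n + 1) T' y, e.idem _ _ _⟩, Subtype.ext ?_⟩
  rw [← fixedIncl_fixedRes]
  change p • e.map (n + 1) T' y = _
  rw [← map_nsmul, ← e.mem_fixed.1 (e.fixedIncl n T' (e.fixedRes n f x)).2]
  exact congrArg _ (funext hy)

/-- The transition maps between the group schemes of fixed points. -/
def trans (n : ℕ) : e.grp n ⟶ e.grp (n + 1) :=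
  commGrpHomOfPoints (fun T => MonoidHom.toAdditive.symm
    (((e.ptsEquiv (n + 1) T).symm.toAddMonoidHom.comp (e.fixedIncl n T)).comp
      (e.ptsEquiv n T).toAddMonoidHom)) fun T T' g x => by
    apply Additive.ofMul.injective
    apply (e.ptsEquiv (n + 1) T').injective
    rw [ptsEquiv_res]
    refine ((e.ptsEquiv (n + 1) T').apply_symm_apply _).trans ?_
    refine Eq.trans ?_ (congrArg _ ((e.ptsEquiv (n + 1) T).apply_symm_apply _).symm)
    exact (congrArg _ (ptsEquiv_res e n g x)).trans (e.fixedIncl_fixedRes n g _)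

lemma ptsEquiv_trans (n : ℕ) (T : Over S) (x : T ⟶ (e.grp n).X) :
    e.ptsEquiv (n + 1) T (Additive.ofMul (x ≫ (e.trans n).hom.hom.hom)) =
      e.fixedIncl n T (e.ptsEquiv n T (Additive.ofMul x)) := by
  rw [trans, comp_commGrpHomOfPoints]
  exact (e.ptsEquiv (n + 1) T).apply_symm_apply _

/-- The `p`-divisible group of fixed points of an idempotent. -/
def pDivGroup : PDivGroup p S where
  G := Functor.ofSequence e.trans
  finite n := (e.scheme_isFinFlat n).finite
  flat n := (e.scheme_isFinFlat n).flat
  locallyOfFinitePresentation n := (e.scheme_isFinFlat n).locallyOfFinitePresentation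
  incl_injective n T x y h := by
    simp only [Functor.ofSequence_map_homOfLE_succ] at h
    apply Additive.ofMul.injective
    apply (e.ptsEquiv n T).injective
    apply e.fixedIncl_injective n T
    exact (e.ptsEquiv_trans n T x).symm.trans ((congrArg _ h).trans (e.ptsEquiv_trans n T y))
  torsion n T y := by
    simp only [Functor.ofSequence_map_homOfLE_succ]
    have h1 : y ^ p ^ n = 1 ↔ p ^ n • e.ptsEquiv (n + 1) T (Additive.ofMul y) = 0 := by
      rw [← map_nsmul, EmbeddingLike.map_eq_zero_iff]
      exact Iff.rfl
    rw [h1, nsmul_eq_zero_iff]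
    constructor
    · rintro ⟨x, hx⟩
      refine ⟨Additive.toMul ((e.ptsEquiv n T).symm x), ?_⟩
      apply Additive.ofMul.injective
      apply (e.ptsEquiv (n + 1) T).injective
      refine (e.ptsEquiv_trans n T _).trans ?_
      exact (congrArg _ ((e.ptsEquiv n T).apply_symm_apply x)).trans hx
    · rintro ⟨x, hx⟩
      exact ⟨_, (e.ptsEquiv_trans n T x).symm.trans (congrArg _ (congrArg Additive.ofMul hx))⟩
  divisible n T x := by
    obtain ⟨T', f, ⟨h1, h2, h3⟩, y, hy⟩ := e.exists_nsmul_eq n (e.ptsEquiv n T (Additive.ofMul x))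
    refine ⟨T', f, h1, h2, h3, Additive.toMul ((e.ptsEquiv (n + 1) T').symm y), ?_⟩
    simp only [Functor.ofSequence_map_homOfLE_succ]
    apply Additive.ofMul.injective
    apply (e.ptsEquiv (n + 1) T').injective
    refine Eq.trans ?_ (hy.trans ?_)
    · refine Eq.trans (map_nsmul (e.ptsEquiv (n + 1) T') p ((e.ptsEquiv (n + 1) T').symm y)) ?_
      rw [AddEquiv.apply_symm_apply]
    · exact (congrArg _ (e.ptsEquiv_trans n T x)).symm.trans (e.ptsEquiv_res (n + 1) f _).symm

/-- The points of the `p`-divisible group of fixed points. -/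
def pDivEquiv (n : ℕ) (T : Over S) : e.pDivGroup.Pts n T ≃+ e.fixed n T := e.ptsEquiv n T

lemma pDivEquiv_res (n : ℕ) {T T' : Over S} (f : T' ⟶ T) (x : e.pDivGroup.Pts n T) :
    e.pDivEquiv n T' (e.pDivGroup.res n f x) = e.fixedRes n f (e.pDivEquiv n T x) :=
  e.ptsEquiv_res n f x.hom

lemma pDivEquiv_incl (n : ℕ) (T : Over S) (x : e.pDivGroup.Pts n T) :
    e.pDivEquiv (n + 1) T (e.pDivGroup.incl n T x) = e.fixedIncl n T (e.pDivEquiv n T x) := by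
  refine Eq.trans ?_ (e.ptsEquiv_trans n T x.hom)
  have h : e.pDivGroup.G.map (homOfLE n.le_succ) = e.trans n :=
    Functor.ofSequence_map_homOfLE_succ _ _
  change e.ptsEquiv (n + 1) T (Additive.ofMul (x.hom ≫ (e.pDivGroup.G.map _).hom.hom.hom)) = _
  rw [h]
  rfl

end PowIdempotent

end PDivGroup

end KisinTwist
end

noncomputable section

namespace KisinTwist


/-! ### The twist of a module as a retract of a finite power -/

section

variable {R : Type w} [CommRing R] {H B : Type v} [CommRing H] [HopfAlgebra R H] [CommRing B]
  [Algebra R B] {E : Type u} [Ring E] [Algebra R E] {M : Type*} [AddCommGroup M] [Module R M]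
  {M' : Type*} [AddCommGroup M'] [Module R M']

namespace GroupHom

variable (ρ : GroupHom R H E) (P : Torsor R H B)

/-- An expression of the universal transport as a sum of pure tensors, together with a functional
on `O_P`: it makes the twist of any `M` a retract of `M ^ k`. -/
structure TransportSum (k : ℕ) where
  l : B →ₗ[R] R
  left : Fin k → B
  right : Fin k → B
  elt : Fin k → E
  map_one : l 1 = 1
  eq_sum : ρ.transportElt P = ∑ i, (left i ⊗ₜ right i) ⊗ₜ elt i

lemma exists_transportSum (l : B →ₗ[R] R) (hl : l 1 = 1) :
    ∃ k, Nonempty (ρ.TransportSum P k) := by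
  obtain ⟨k, x, y, z, h⟩ := exists_sum_tmul_tmul_eq (ρ.transportElt P)
  exact ⟨k, ⟨⟨l, x, y, z, hl, h⟩⟩⟩

namespace TransportSum

variable {ρ P} {k : ℕ} (s : ρ.TransportSum P k) (θ : E →ₐ[R] Module.End R M)
  (θ' : E →ₐ[R] Module.End R M')

/-- The coordinates in `M ^ k` of an element of `O_P ⊗ M`. -/
def coords (M : Type*) [AddCommGroup M] [Module R M] : B ⊗[R] M →ₗ[R] (Fin k → M) :=
  LinearMap.pi fun i => contract M (s.l ∘ₗ LinearMap.mulLeft R (s.left i))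

/-- The element of the twist with given coordinates. -/
def build : (Fin k → M) →ₗ[R] B ⊗[R] M :=
  -- The projection puts the result in the twist for arbitrary coordinates; for those of an element
  -- of the twist it changes nothing.
  ρ.twistProj θ P s.l ∘ₗ ∑ i, TensorProduct.mk R B M (s.right i) ∘ₗ θ (s.elt i) ∘ₗ LinearMap.proj i

lemma build_apply (v : Fin k → M) :
    s.build θ v = ρ.twistProj θ P s.l (∑ i, s.right i ⊗ₜ θ (s.elt i) (v i)) := by
  simp [build]

lemma build_mem (v : Fin k → M) : s.build θ v ∈ twist ρ P θ :=
  ρ.twistProj_mem θ P _ _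

/-- By `twistProj_eq_sum` the sum built from the coordinates of `x` is the projection of `x`, which
is `x` itself. -/
lemma build_coords {x : B ⊗[R] M} (hx : x ∈ twist ρ P θ) : s.build θ (s.coords M x) = x := by
  have h : ∑ i, s.right i ⊗ₜ θ (s.elt i) (s.coords M x i) = x :=
    (ρ.twistProj_eq_sum θ P s.l s.eq_sum x).symm.trans (ρ.twistProj_eq θ P s.map_one hx)
  rw [build_apply, h, ρ.twistProj_eq θ P s.map_one hx]

lemma coords_lTensor (g : M →ₗ[R] M') (x : B ⊗[R] M) (i : Fin k) :
    s.coords M' (LinearMap.lTensor B g x) i = g (s.coords M x i) :=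
  contract_lTensor _ g x

lemma lTensor_build (g : M →ₗ[R] M') (hg : ∀ e m, g (θ e m) = θ' e (g m)) (v : Fin k → M) :
    LinearMap.lTensor B g (s.build θ v) = s.build θ' fun i => g (v i) := by
  rw [build_apply, build_apply, ρ.lTensor_twistProj θ θ' P s.l g hg]
  simp [hg]

end TransportSum

end GroupHom

end

/-! ### Representability of the twist of a `p`-divisible group -/

namespace PDivGroup

variable {p : ℕ} [Fact p.Prime] {S : Scheme.{u}} (D : PDivGroup p S)

lemma res_ptsAction (n : ℕ) {T T' : Over S} (f : T' ⟶ T) (e : D.EndRing) (x : D.Pts n T) :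
    D.res n f (D.ptsAction n T e x) = D.ptsAction n T' e (D.res n f x) :=
  (Category.assoc f x.hom (e.app n).hom.hom.hom).symm

lemma incl_ptsAction (n : ℕ) (T : Over S) (e : D.EndRing) (x : D.Pts n T) :
    D.incl n T (D.ptsAction n T e x) = D.ptsAction (n + 1) T e (D.incl n T x) :=
  (ptsMap_incl e n T x).symm

variable {H B : Type v} [CommRing H] [HopfAlgebra ℤ_[p] H] [CommRing B] [Algebra ℤ_[p] B]
  {ρ : GroupHom ℤ_[p] H D.EndRing} {P : Torsor ℤ_[p] H B} {k : ℕ} (s : ρ.TransportSum P k)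

/-- The idempotent on `D^k` whose image is the twist of `D`. -/
def twistIdempotent : D.PowIdempotent k where
  map n T := (s.coords (D.Pts n T) ∘ₗ s.build (D.ptsAction n T)).toAddMonoidHom
  -- `build` after `coords` is the identity on the twist, so `coords` after `build` is idempotent.
  idem n T v := congrArg (s.coords (D.Pts n T)) (s.build_coords _ (s.build_mem _ v))
  map_res n T T' f v i := by
    refine Eq.trans ?_ (s.coords_lTensor (D.res n f) (s.build (D.ptsAction n T) v) i)
    rw [s.lTensor_build _ (D.ptsAction n T') _ (D.res_ptsAction n f)]
    rfl
  map_incl n T v i := by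
    refine Eq.trans ?_ (s.coords_lTensor (D.incl n T) (s.build (D.ptsAction n T) v) i)
    rw [s.lTensor_build _ (D.ptsAction (n + 1) T) _ (D.incl_ptsAction n T)]
    rfl

/-- The fixed points of the idempotent are the twist. -/
def fixedEquivTwist (n : ℕ) (T : Over S) :
    (D.twistIdempotent s).fixed n T ≃+ D.twistPts ρ P n T where
  toFun v := ⟨s.build (D.ptsAction n T) v.1, s.build_mem _ _⟩
  invFun x := ⟨s.coords (D.Pts n T) x.1, congrArg (s.coords (D.Pts n T)) (s.build_coords _ x.2)⟩
  left_inv v := Subtype.ext v.2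
  right_inv x := Subtype.ext (s.build_coords _ x.2)
  map_add' v w := Subtype.ext (map_add (s.build (D.ptsAction n T)) v.1 w.1)

/-- The twist of a `p`-divisible group is represented by a `p`-divisible group. -/
def twistRep : D.TwistRep ρ P (D.twistIdempotent s).pDivGroup where
  equiv n T := ((D.twistIdempotent s).pDivEquiv n T).trans (D.fixedEquivTwist s n T)
  equiv_res n T T' f x := by
    rw [AddEquiv.trans_apply, AddEquiv.trans_apply, PowIdempotent.pDivEquiv_res]
    exact (s.lTensor_build _ (D.ptsAction n T') _ (D.res_ptsAction n f) _).symm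
  equiv_incl n T x := by
    rw [AddEquiv.trans_apply, AddEquiv.trans_apply, PowIdempotent.pDivEquiv_incl]
    exact (s.lTensor_build _ (D.ptsAction (n + 1) T) _ (D.incl_ptsAction n T) _).symm

theorem exists_twistRep (ρ : GroupHom ℤ_[p] H D.EndRing) (P : Torsor ℤ_[p] H B) :
    ∃ E : PDivGroup p S, Nonempty (D.TwistRep ρ P E) := by
  have := P.faithfullyFlat
  obtain ⟨l, hl⟩ := exists_functional_one (p := p) (B := B)
  obtain ⟨k, ⟨s⟩⟩ := ρ.exists_transportSum P l hl
  exact ⟨_, ⟨D.twistRep s⟩⟩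

end PDivGroup

end KisinTwist
end

noncomputable section

namespace KisinTwist


section FiniteGeneration

variable {p : ℕ} [Fact p.Prime]

/-! ### Finiteness of Tate modules -/

/-- The series `∑ p^n c_n` converges by completeness, and its tail from `N` on is divisible by
`p^N`. -/
lemma exists_padic_sum (c : ℕ → ℤ_[p]) : ∃ a : ℤ_[p], ∀ N : ℕ, ∃ d : ℤ_[p],
    a = ∑ n ∈ Finset.range N, (p : ℤ_[p]) ^ n * c n + (p : ℤ_[p]) ^ N * d := by
  have hI (N : ℕ) (x y : ℤ_[p]) :
      x ≡ y [SMOD (IsLocalRing.maximalIdeal ℤ_[p] ^ N • ⊤ : Submodule ℤ_[p] ℤ_[p])] ↔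
        (p : ℤ_[p]) ^ N ∣ x - y := by
    rw [SModEq.sub_mem, PadicInt.maximalIdeal_eq_span_p, Ideal.span_singleton_pow, smul_eq_mul,
      Ideal.mul_top, Ideal.mem_span_singleton]
  obtain ⟨a, ha⟩ := IsPrecomplete.prec (I := IsLocalRing.maximalIdeal ℤ_[p]) (M := ℤ_[p])
    inferInstance (f := fun N => ∑ n ∈ Finset.range N, (p : ℤ_[p]) ^ n * c n) (by
      intro m n hmn
      rw [hI, ← neg_sub, dvd_neg, ← Finset.sum_Ico_eq_sub _ hmn]
      exact Finset.dvd_sum fun i hi => (pow_dvd_pow _ (Finset.mem_Ico.1 hi).1).mul_right _)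
  refine ⟨a, fun N => ?_⟩
  obtain ⟨d, hd⟩ := (hI _ _ _).1 (ha N)
  exact ⟨-d, by rw [mul_neg, ← hd]; ring⟩

/-- A `p`-adically separated `ℤ_p`-module that is finite modulo `p` is finitely generated. -/
lemma finite_of_separated {V : Type*} [AddCommGroup V] [Module ℤ_[p] V] {J : Type*} [Finite J]
    (m : J → V) (hm : ∀ x, ∃ j y, x = m j + (p : ℤ_[p]) • y)
    (hV : ∀ x : V, (∀ n : ℕ, ∃ y, x = (p : ℤ_[p]) ^ n • y) → x = 0) : Module.Finite ℤ_[p] V := by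
  classical
  have := Fintype.ofFinite J
  choose j r hr using hm
  refine Module.Finite.of_surjective (Fintype.linearCombination ℤ_[p] m) fun x => ?_
  have hx (N : ℕ) : x = ∑ n ∈ Finset.range N, (p : ℤ_[p]) ^ n • m (j (r^[n] x)) +
      (p : ℤ_[p]) ^ N • r^[N] x := by
    induction N with
    | zero => simp
    | succ N ih =>
      rw [Finset.sum_range_succ, pow_succ, mul_smul, Function.iterate_succ_apply', add_assoc,
        ← smul_add, ← hr, ← ih]
  -- The coefficient of `m i` collects `p^n` over the places `n` at which the digit is `i`.
  choose a ha using fun i : J =>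
    exists_padic_sum fun n => if j (r^[n] x) = i then (1 : ℤ_[p]) else 0
  refine ⟨a, (sub_eq_zero.1 (hV _ fun N => ?_)).symm⟩
  choose d hd using fun i => ha i N
  refine ⟨r^[N] x - ∑ i, d i • m i, ?_⟩
  have h1 : ∑ i, a i • m i = ∑ n ∈ Finset.range N, (p : ℤ_[p]) ^ n • m (j (r^[n] x)) +
      (p : ℤ_[p]) ^ N • ∑ i, d i • m i := by
    rw [Finset.sum_congr rfl fun i _ => congrArg (· • m i) (hd i)]
    simp only [add_smul, Finset.sum_smul, Finset.sum_add_distrib, Finset.smul_sum, mul_smul]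
    rw [Finset.sum_comm]
    simp
  rw [Fintype.linearCombination_apply, h1, smul_sub]
  nth_rewrite 1 [hx N]
  abel

end FiniteGeneration

/-! ### Geometric points of finite schemes -/

/-- Sections are algebra maps to `Ω` from a finite-dimensional `Ω`-algebra, of which there are
finitely many. -/
lemma finite_sections {Ω : Type u} [Field Ω] {X : Scheme.{u}} (g : X ⟶ Spec (.of Ω))
    [IsFinite g] : Finite {s : Spec (.of Ω) ⟶ X // s ≫ g = 𝟙 _} := by
  have : IsAffine X := isAffine_of_isAffineHom g
  obtain ⟨h, hh⟩ := Spec.map_surjective (X.isoSpec.inv ≫ g)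
  have hfin : h.hom.Finite := by
    rw [← IsFinite.SpecMap_iff, hh]
    infer_instance
  let := h.hom.toAlgebra
  have : Module.Finite Ω Γ(X, ⊤) := hfin
  have hs (s : {s : Spec (.of Ω) ⟶ X // s ≫ g = 𝟙 _}) :
      h ≫ Spec.preimage (s.1 ≫ X.isoSpec.hom) = 𝟙 _ := by
    apply Spec.map_injective
    rw [Spec.map_comp, Spec.map_preimage, hh, Category.assoc, Iso.hom_inv_id_assoc, s.2,
      Spec.map_id]
  let F (s : {s : Spec (.of Ω) ⟶ X // s ≫ g = 𝟙 _}) : Γ(X, ⊤) →ₐ[Ω] Ω :=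
    { (Spec.preimage (s.1 ≫ X.isoSpec.hom)).hom with
      commutes' := fun r => congrArg (fun f => f.hom r) (hs s) }
  refine Finite.of_injective F fun s s' hss => Subtype.ext ?_
  rw [← cancel_mono X.isoSpec.hom]
  have h1 : Spec.preimage (s.1 ≫ X.isoSpec.hom) = Spec.preimage (s'.1 ≫ X.isoSpec.hom) := by
    ext x
    exact congrArg (fun f : Γ(X, ⊤) →ₐ[Ω] Ω => f x) hss
  rw [← Spec.map_preimage (s.1 ≫ X.isoSpec.hom), h1, Spec.map_preimage]

/-- Points above `f` inject into the sections of the base change along `f`. -/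
lemma finite_overHom {S : Scheme.{u}} {Ω : Type u} [Field Ω] (f : Spec (.of Ω) ⟶ S) (X : Over S)
    [IsFinite X.hom] : Finite (Over.mk f ⟶ X) := by
  have := finite_sections (Limits.pullback.snd X.hom f)
  refine Finite.of_injective (β := {s : Spec (.of Ω) ⟶ Limits.pullback X.hom f //
    s ≫ Limits.pullback.snd X.hom f = 𝟙 _}) (fun x => ⟨Limits.pullback.lift x.left (𝟙 _)
      (by rw [Category.id_comp]; exact Over.w x), Limits.pullback.lift_snd _ _ _⟩) fun x y h => ?_
  ext1
  have := congrArg (fun s => s.1 ≫ Limits.pullback.fst X.hom f) h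
  exact (Limits.pullback.lift_fst _ _ _).symm.trans (this.trans (Limits.pullback.lift_fst _ _ _))

/-! ### Torsion-freeness and finiteness of the Tate module -/

namespace PDivGroup

variable {p : ℕ} [Fact p.Prime] {S : Scheme.{u}} (D : PDivGroup p S)

lemma natCast_smul_pts {n : ℕ} {T : Over S} (x : D.Pts n T) : (p : ℤ_[p]) • x = p • x :=
  Nat.cast_smul_eq_nsmul _ _ _

/-- If `p x = 0`, then `x n`, included in the next level, is `p • x (n + 1) = 0`. A nonzero scalar
is a unit times a power of `p`. -/
lemma tate_isTorsionFree (T : Over S) : Module.IsTorsionFree ℤ_[p] (D.tate T) := by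
  have hp (x : D.tate T) (hx : (p : ℤ_[p]) • x = 0) : x = 0 := by
    ext n
    apply D.incl_inj n T
    rw [← x.2 n, ← natCast_smul_pts]
    exact (congrFun (congrArg Subtype.val hx) (n + 1)).trans (map_zero _).symm
  have hpn (n : ℕ) (x : D.tate T) (hx : (p : ℤ_[p]) ^ n • x = 0) : x = 0 := by
    induction n with
    | zero => simpa using hx
    | succ n ih => rw [pow_succ', mul_smul] at hx; exact ih (hp _ hx)
  refine Module.isTorsionFree_iff_smul_eq_zero.2 fun r x h => ?_
  refine or_iff_not_imp_left.2 fun hr => ?_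
  rw [PadicInt.unitCoeff_spec hr, mul_comm, mul_smul] at h
  have h2 := hpn _ _ h
  exact (PadicInt.unitCoeff hr).isUnit.smul_eq_zero.1 h2

/-- When `x 1 = 0`, the term `x (n + 1)` is already killed by `p^n`, so it comes from level `n`; the
shifted sequence is `x` divided by `p`. -/
lemma exists_eq_smul_of_tateProj_one {T : Over S} {x : D.tate T} (hx : D.tateProj 1 T x = 0) :
    ∃ y : D.tate T, x = (p : ℤ_[p]) • y := by
  have h1 (n : ℕ) : p ^ n • x.1 (n + 1) = 0 := by
    induction n with
    | zero => rw [pow_zero, one_smul]; exact hx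
    | succ n ih => rw [pow_succ, mul_smul, x.2, ← map_nsmul, ih, map_zero]
  choose y hy using fun n => (D.nsmul_eq_zero_iff n T _).1 (h1 n)
  refine ⟨⟨y, fun n => ?_⟩, ?_⟩
  · apply D.incl_inj (n + 1) T
    rw [map_nsmul, hy, x.2, hy]
  · ext n
    apply D.incl_inj n T
    rw [← x.2 n, ← hy n, ← map_nsmul, ← natCast_smul_pts]
    rfl

/-- Modulo `p` the Tate module embeds in the finite group `D[p](T)`. It is separated because `p^n`
kills level `n`. -/
lemma tate_finite {T : Over S} [Finite (D.Pts 1 T)] : Module.Finite ℤ_[p] (D.tate T) := by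
  let J := LinearMap.range (D.tateProj 1 T)
  choose m hm using fun j : J => j.2
  refine finite_of_separated m (fun x => ?_) fun x hx => ?_
  · obtain ⟨y, hy⟩ := D.exists_eq_smul_of_tateProj_one (x := x - m ⟨D.tateProj 1 T x, x, rfl⟩)
      (by rw [map_sub, hm, sub_self])
    exact ⟨_, y, by rw [← hy]; abel⟩
  · ext n
    obtain ⟨y, rfl⟩ := hx n
    change (p : ℤ_[p]) ^ n • y.1 n = 0
    rw [← Nat.cast_pow, Nat.cast_smul_eq_nsmul, pow_nsmul_eq_zero]

lemma finite_pts_genPt [IsIntegral S] (Ω : Type u) [Field Ω] [Algebra S.functionField Ω] (n : ℕ) :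
    Finite (D.Pts n (genPt S Ω)) :=
  have := D.finite n
  finite_overHom _ (D.G.obj n).X

end PDivGroup

end KisinTwist
end

noncomputable section

namespace KisinTwist


/-! ### Functoriality of the tensor space -/

/-- The coordinates of `f x` are the images in `A` of those of `x`. -/
lemma injective_of_basis {R A V W J : Type*} [CommRing R] [CommRing A] [Algebra R A]
    [AddCommMonoid V] [Module R V] [AddCommMonoid W] [Module R W] [Module A W]
    [IsScalarTower R A W] (h : Function.Injective (algebraMap R A)) (b : Module.Basis J R V) (b' : Module.Basis J A W)
    (f : V →ₗ[R] W) (hf : ∀ j, f (b j) = b' j) : Function.Injective f := by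
  have key (x : V) (j : J) : b'.repr (f x) j = algebraMap R A (b.repr x j) := by
    have h1 : f x = b'.repr.symm ((b.repr x).mapRange (algebraMap R A) (map_zero _)) := by
      nth_rewrite 1 [← b.linearCombination_repr x]
      rw [Module.Basis.repr_symm_apply, Finsupp.linearCombination_apply,
        Finsupp.linearCombination_apply, map_finsuppSum, Finsupp.sum_mapRange_index (by simp)]
      simp [hf]
    rw [h1, LinearEquiv.apply_symm_apply, Finsupp.mapRange_apply]
  refine fun x y hxy => b.ext_elem fun j => h ?_
  rw [← key, ← key, hxy]

namespace TensorSpace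

section Map

variable {A : Type*} [CommRing A] {N N' N'' : Type*} [AddCommGroup N] [Module A N]
  [AddCommGroup N'] [Module A N'] [AddCommGroup N''] [Module A N'']

lemma map_trans (g : N ≃ₗ[A] N') (g' : N' ≃ₗ[A] N'') (t : TensorSpace A N) :
    map (g.trans g') t = map g' (map g t) := by
  refine DFinsupp.ext fun i => ?_
  simp only [map, DirectSum.lmap_apply]
  rw [← LinearMap.comp_apply, ← TensorProduct.map_comp, ← PiTensorProduct.map_comp,
    ← PiTensorProduct.map_comp]
  rfl

lemma map_refl (t : TensorSpace A N) : map (LinearEquiv.refl A N) t = t := by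
  refine DFinsupp.ext fun i => ?_
  simp only [map, DirectSum.lmap_apply]
  have h1 : (LinearEquiv.refl A N).toLinearMap = LinearMap.id := rfl
  have h2 : (LinearEquiv.refl A N).symm.toLinearMap.dualMap = LinearMap.id := rfl
  rw [h1, h2, PiTensorProduct.map_id, PiTensorProduct.map_id, TensorProduct.map_id]
  rfl

lemma map_symm_map (g : N ≃ₗ[A] N') (t : TensorSpace A N) : map g.symm (map g t) = t := by
  rw [← map_trans, LinearEquiv.self_trans_symm, map_refl]

lemma map_map_symm (g : N ≃ₗ[A] N') (t : TensorSpace A N') : map g (map g.symm t) = t := by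
  rw [← map_trans, LinearEquiv.symm_trans_self, map_refl]

end Map

section Ext

variable {R : Type*} [CommRing R] (A : Type*) [CommRing A] [Algebra R A]
  {M M' : Type*} [AddCommGroup M] [Module R M] [AddCommGroup M'] [Module R M']

lemma powExt_tprod {L N : Type*} [AddCommGroup L] [Module R L] [AddCommGroup N] [Module R N]
    [Module A N] [IsScalarTower R A N] (f : L →ₗ[R] N) (n : ℕ) (v : Fin n → L) :
    powExt R A f n (⨂ₜ[R] i, v i) = ⨂ₜ[A] i, f (v i) := by
  rw [powExt, PiTensorProduct.lift.tprod]
  rfl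

/-- Extension of scalars on the component of bidegree `i`. -/
def extMixed (M : Type*) [AddCommGroup M] [Module R M] (i : ℕ × ℕ) :
    Mixed R M i →ₗ[R] Mixed A (A ⊗[R] M) i :=
  TensorProduct.lift
    (((TensorProduct.mk A (⨂[A] _ : Fin i.1, A ⊗[R] M)
      (⨂[A] _ : Fin i.2, Module.Dual A (A ⊗[R] M))).restrictScalars₁₂ R R).compl₁₂
        (powExt R A (TensorProduct.mk R A M 1) i.1)
        (powExt R A (Module.Dual.baseChange A) i.2))

lemma ext_apply (t : TensorSpace R M) (i : ℕ × ℕ) :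
    ext R A M t i = extMixed A M i (t i) := rfl

lemma extMixed_tmul (i : ℕ × ℕ) (x : ⨂[R] _ : Fin i.1, M) (y : ⨂[R] _ : Fin i.2, Module.Dual R M) :
    extMixed A M i (x ⊗ₜ y) = powExt R A (TensorProduct.mk R A M 1) i.1 x ⊗ₜ[A]
      powExt R A (Module.Dual.baseChange A) i.2 y := rfl

lemma map_ext (g : M ≃ₗ[R] M') (t : TensorSpace R M) :
    map (g.baseChange R A M M') (ext R A M t) = ext R A M' (map g t) := by
  refine DFinsupp.ext fun i => ?_
  simp only [map, DirectSum.lmap_apply, ext_apply]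
  generalize t i = x
  induction x using TensorProduct.induction_on with
  | zero => simp only [map_zero]
  | add x y hx hy => simp only [map_add, hx, hy]
  | tmul x y =>
    rw [TensorProduct.map_tmul, extMixed_tmul, extMixed_tmul, TensorProduct.map_tmul]
    congr 1
    · induction x using PiTensorProduct.induction_on with
      | smul_tprod r v => simp [powExt_tprod]
      | add x y hx hy => simp only [map_add, hx, hy]
    · induction y using PiTensorProduct.induction_on with
      | smul_tprod r v =>
        simp only [map_smul, powExt_tprod, PiTensorProduct.map_tprod]
        rw [← IsScalarTower.algebraMap_smul A r, ← IsScalarTower.algebraMap_smul A r, map_smul,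
          PiTensorProduct.map_tprod]
        congr 2
        funext j
        apply TensorProduct.AlgebraTensorModule.ext
        intro a m
        simp
      | add x y hx hy => simp only [map_add, hx, hy]

/-- Extension of scalars sends the basis of mixed tensors made from a basis and its dual to the one
made from the base-changed basis. -/
lemma ext_injective [Module.Free R M] [Module.Finite R M]
    (h : Function.Injective (algebraMap R A)) : Function.Injective (ext R A M) := by
  classical
  let b := Module.Free.chooseBasis R M
  let b' := b.baseChange A
  have hb' (j) : Module.Dual.baseChange A (b.dualBasis j) = b'.dualBasis j := by
    refine b'.ext fun k => ?_
    simp [b', Module.Basis.baseChange_apply, Finsupp.single_apply]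
  intro t t' htt
  refine DFinsupp.ext fun i => ?_
  have h1 := DFinsupp.ext_iff.1 htt i
  rw [ext_apply, ext_apply] at h1
  have hinj : Function.Injective (extMixed A M i) := injective_of_basis h
    ((Basis.piTensorProduct fun _ : Fin i.1 => b).tensorProduct
      (Basis.piTensorProduct fun _ : Fin i.2 => b.dualBasis))
    ((Basis.piTensorProduct fun _ : Fin i.1 => b').tensorProduct
      (Basis.piTensorProduct fun _ : Fin i.2 => b'.dualBasis)) (extMixed A M i) ?_
  · exact hinj h1
  rintro ⟨j, k⟩
  rw [Module.Basis.tensorProduct_apply, Module.Basis.tensorProduct_apply, extMixed_tmul,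
    Basis.piTensorProduct_apply, Basis.piTensorProduct_apply, Basis.piTensorProduct_apply,
    Basis.piTensorProduct_apply, powExt_tprod, powExt_tprod]
  simp only [hb']
  congr 2
  funext l
  exact (b.baseChange_apply A (j l)).symm

end Ext

end TensorSpace

end KisinTwist
end

noncomputable section

namespace KisinTwist


namespace PDivGroup

variable {p : ℕ} [Fact p.Prime] {S : Scheme.{u}} {D D' : PDivGroup p S}

/-! ### Homomorphisms given by their action on points -/

lemma hom_ext_pts {g g' : D.G ⟶ D'.G} (h : ∀ (n : ℕ) (T : Over S) (x : D.Pts n T),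
    ptsMap le_rfl (g.app n) T x = ptsMap le_rfl (g'.app n) T x) : g = g' := by
  refine NatTrans.ext (funext fun n => ?_)
  ext1
  have h1 : 𝟙 _ ≫ (g.app n).hom.hom.hom = 𝟙 _ ≫ (g'.app n).hom.hom.hom :=
    h n (D.G.obj n).X (toPts (𝟙 _))
  rwa [Category.id_comp, Category.id_comp] at h1

/-- A natural homomorphism on points, compatible with the inclusions, comes from a homomorphism of
`p`-divisible groups. -/
def homOfPts (f : ∀ (n : ℕ) (T : Over S), D.Pts n T →+ D'.Pts n T)
    (hres : ∀ (n : ℕ) {T T' : Over S} (g : T' ⟶ T) (x : D.Pts n T),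
      f n T' (D.res n g x) = D'.res n g (f n T x))
    (hincl : ∀ (n : ℕ) (T : Over S) (x : D.Pts n T),
      f (n + 1) T (D.incl n T x) = D'.incl n T (f n T x)) : D.G ⟶ D'.G :=
  NatTrans.ofSequence
    (fun n => commGrpHomOfPoints (fun T => MonoidHom.toAdditive.symm (f n T))
      fun _ _ g x => hres n g (toPts x)) fun n => by
    ext1
    refine (comp_commGrpHomOfPoints _ _ _).trans ?_
    refine (congrArg (f (n + 1) _) (congrArg toPts (Category.id_comp _).symm)).trans ?_
    exact hincl n (D.G.obj n).X (toPts (𝟙 _))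

lemma ptsMap_homOfPts (f : ∀ (n : ℕ) (T : Over S), D.Pts n T →+ D'.Pts n T)
    (hres : ∀ (n : ℕ) {T T' : Over S} (g : T' ⟶ T) (x : D.Pts n T),
      f n T' (D.res n g x) = D'.res n g (f n T x))
    (hincl : ∀ (n : ℕ) (T : Over S) (x : D.Pts n T),
      f (n + 1) T (D.incl n T x) = D'.incl n T (f n T x)) (n : ℕ) (T : Over S) (x : D.Pts n T) :
    ptsMap le_rfl ((homOfPts f hres hincl).app n) T x = f n T x :=
  comp_commGrpHomOfPoints _ _ x.hom

lemma ptsMap_comp {D'' : PDivGroup p S} (g : D.G ⟶ D'.G) (g' : D'.G ⟶ D''.G) (n : ℕ) (T : Over S)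
    (x : D.Pts n T) : ptsMap le_rfl ((g ≫ g').app n) T x =
      ptsMap le_rfl (g'.app n) T (ptsMap le_rfl (g.app n) T x) :=
  (Category.assoc x.hom (g.app n).hom.hom.hom (g'.app n).hom.hom.hom).symm

lemma ptsMap_id (n : ℕ) (T : Over S) (x : D.Pts n T) :
    ptsMap le_rfl ((𝟙 D.G : D.G ⟶ D.G).app n) T x = x :=
  Category.comp_id x.hom

/-- Natural isomorphisms on points, compatible with the inclusions, come from an isomorphism of
`p`-divisible groups. -/
def isoOfPts (f : ∀ (n : ℕ) (T : Over S), D.Pts n T ≃+ D'.Pts n T)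
    (hres : ∀ (n : ℕ) {T T' : Over S} (g : T' ⟶ T) (x : D.Pts n T),
      f n T' (D.res n g x) = D'.res n g (f n T x))
    (hincl : ∀ (n : ℕ) (T : Over S) (x : D.Pts n T),
      f (n + 1) T (D.incl n T x) = D'.incl n T (f n T x)) : D.G ≅ D'.G where
  hom := homOfPts (fun n T => (f n T).toAddMonoidHom) hres hincl
  inv := homOfPts (fun n T => (f n T).symm.toAddMonoidHom)
    (fun n T T' g x => (f n T').injective (by
      refine ((f n T').apply_symm_apply _).trans ((hres n g _).trans ?_).symm
      exact congrArg _ ((f n T).apply_symm_apply x)))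
    (fun n T x => (f (n + 1) T).injective (by
      refine ((f (n + 1) T).apply_symm_apply _).trans ((hincl n T _).trans ?_).symm
      exact congrArg _ ((f n T).apply_symm_apply x)))
  hom_inv_id := hom_ext_pts fun n T x => by
    rw [ptsMap_comp, ptsMap_id, ptsMap_homOfPts]
    exact (congrArg (f n T).symm (ptsMap_homOfPts _ hres hincl n T x)).trans
      ((f n T).symm_apply_apply x)
  inv_hom_id := hom_ext_pts fun n T x => by
    rw [ptsMap_comp, ptsMap_id, ptsMap_homOfPts]
    exact (ptsMap_homOfPts _ hres hincl n T _).trans ((f n T).apply_symm_apply x)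

lemma ptsMap_isoOfPts (f : ∀ (n : ℕ) (T : Over S), D.Pts n T ≃+ D'.Pts n T)
    (hres : ∀ (n : ℕ) {T T' : Over S} (g : T' ⟶ T) (x : D.Pts n T),
      f n T' (D.res n g x) = D'.res n g (f n T x))
    (hincl : ∀ (n : ℕ) (T : Over S) (x : D.Pts n T),
      f (n + 1) T (D.incl n T x) = D'.incl n T (f n T x)) (n : ℕ) (T : Over S) (x : D.Pts n T) :
    ptsMap le_rfl ((isoOfPts f hres hincl).hom.app n) T x = f n T x :=
  ptsMap_homOfPts _ hres hincl n T x

/-! ### The twist by a trivial torsor -/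

variable {H B : Type v} [CommRing H] [HopfAlgebra ℤ_[p] H] [CommRing B] [Algebra ℤ_[p] B]
  {ρ : GroupHom ℤ_[p] H D.EndRing} {P : Torsor ℤ_[p] H B} {E : PDivGroup p S}

namespace TwistRep

variable (e : D.TwistRep ρ P E) (y : B →ₐ[ℤ_[p]] ℤ_[p])

/-- A `ℤ_p`-point of the torsor identifies the points of the twist with those of `D`. -/
def ptsEquiv (n : ℕ) (T : Over S) : E.Pts n T ≃+ D.Pts n T :=
  (e.equiv n T).trans (ρ.trivialize (D.ptsAction n T) P y).toAddEquiv

lemma ptsEquiv_apply (n : ℕ) (T : Over S) (x : E.Pts n T) :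
    e.ptsEquiv y n T x = contract (D.Pts n T) y.toLinearMap (e.equiv n T x) := rfl

lemma ptsEquiv_res (n : ℕ) {T T' : Over S} (g : T' ⟶ T) (x : E.Pts n T) :
    e.ptsEquiv y n T' (E.res n g x) = D.res n g (e.ptsEquiv y n T x) := by
  rw [ptsEquiv_apply, ptsEquiv_apply, e.equiv_res, contract_lTensor]

lemma ptsEquiv_incl (n : ℕ) (T : Over S) (x : E.Pts n T) :
    e.ptsEquiv y (n + 1) T (E.incl n T x) = D.incl n T (e.ptsEquiv y n T x) := by
  rw [ptsEquiv_apply, ptsEquiv_apply, e.equiv_incl, contract_lTensor]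

/-- A `ℤ_p`-point of the torsor identifies the twist with `D`. -/
def iso : E.G ≅ D.G :=
  isoOfPts (e.ptsEquiv y) (e.ptsEquiv_res y) (e.ptsEquiv_incl y)

lemma tateProj_tateEquiv_iso (n : ℕ) (T : Over S) (x : E.tate T) :
    D.tateProj n T (tateEquiv (e.iso y) T x) =
      contract (D.Pts n T) y.toLinearMap (e.equiv n T (E.tateProj n T x)) :=
  ptsMap_isoOfPts _ (e.ptsEquiv_res y) (e.ptsEquiv_incl y) n T (x.1 n)

/-- The comparison of Tate modules over the torsor, described by means of a `ℤ_p`-point. -/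
def comparison (T : Over S) : (B ⊗[ℤ_[p]] E.tate T) ≃ₗ[B] (B ⊗[ℤ_[p]] D.tate T) :=
  (LinearEquiv.baseChange ℤ_[p] B _ _ (tateEquiv (e.iso y) T)).trans
    (ρ.spread (D.tateAction T) P y)

lemma comparison_one_tmul (T : Over S) (x : E.tate T) : e.comparison y T (1 ⊗ₜ x) =
    ρ.spread (D.tateAction T) P y (1 ⊗ₜ tateEquiv (e.iso y) T x) := rfl

/-- Both conditions follow from the fact that spreading the value at `y` recovers an invariant
function, applied to the Tate module and to each level. -/
lemma isTateComparison_comparison (T : Over S) : IsTateComparison e T (e.comparison y T) where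
  range_eq := by
    ext z
    constructor
    · rintro ⟨x, rfl⟩
      exact ρ.spread_mem _ P y _
    · intro hz
      refine ⟨(tateEquiv (e.iso y) T).symm (contract _ y.toLinearMap z), ?_⟩
      change e.comparison y T (1 ⊗ₜ _) = z
      rw [comparison_one_tmul, LinearEquiv.apply_symm_apply]
      exact ρ.spread_contract _ P y hz
  lift n x := by
    rw [comparison_one_tmul, ρ.lTensor_spread _ (D.ptsAction n T) P y _ fun _ _ => rfl,
      LinearMap.lTensor_tmul, tateProj_tateEquiv_iso]
    exact ρ.spread_contract _ P y (e.equiv n T _).2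

/-- `c (1 ⊗ x)` is invariant, hence determined by its value at `y`, and the lifting condition
prescribes that value at every level. In particular the comparison does not depend on `y`. -/
lemma eq_comparison {T : Over S} {c : (B ⊗[ℤ_[p]] E.tate T) ≃ₗ[B] (B ⊗[ℤ_[p]] D.tate T)}
    (hc : IsTateComparison e T c) : c = e.comparison y T := by
  have key (x : E.tate T) : c (1 ⊗ₜ x) = e.comparison y T (1 ⊗ₜ x) := by
    have hmem : c (1 ⊗ₜ x) ∈ twist ρ P (D.tateAction T) := by
      rw [← SetLike.mem_coe, ← hc.range_eq]
      exact ⟨x, rfl⟩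
    rw [comparison_one_tmul, ← ρ.spread_contract _ P y hmem]
    congr 2
    ext n
    refine Eq.trans ?_ (e.tateProj_tateEquiv_iso y n T x).symm
    rw [← hc.lift]
    exact (contract_lTensor _ (D.tateProj n T) _).symm
  apply LinearEquiv.toLinearMap_injective
  apply TensorProduct.AlgebraTensorModule.curry_injective
  ext x : 2
  exact key x

/-- The two isomorphisms differ over `O_P` by the action of an element of `Z(O_P)`, which fixes `t`,
and extension of scalars to `O_P` loses no information. -/
lemma correspondingTensor_comparison_iff {T : Over S} [Module.Free ℤ_[p] (D.tate T)]
    [Module.Finite ℤ_[p] (D.tate T)] {t : TensorSpace ℤ_[p] (D.tate T)}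
    (ht : IsInvariantTensor ρ T t) (t' : TensorSpace ℤ_[p] (E.tate T)) :
    CorrespondingTensor (e.comparison y T) t' t ↔
      TensorSpace.map (tateEquiv (e.iso y) T) t' = t := by
  -- The point `y` is a retraction of `ℤ_p → O_P`.
  have hB : Function.Injective (algebraMap ℤ_[p] B) :=
    Function.LeftInverse.injective (g := y) fun r => y.commutes r
  have hz := ht B (P.div (Torsor.constPt B y) (AlgHom.id ℤ_[p] B))
  rw [CorrespondingTensor, comparison, TensorSpace.map_trans, TensorSpace.map_ext]
  constructor
  · intro h
    apply TensorSpace.ext_injective B hB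
    rw [← hz, ← h]
    exact (TensorSpace.map_map_symm _ _).symm
  · rintro h
    rw [h]
    nth_rewrite 1 [← hz]
    exact TensorSpace.map_symm_map _ _

end TwistRep

end PDivGroup

end KisinTwist
end

/-! ### The main theorem -/

theorem proposition1p3p2 (p : ℕ) [Fact p.Prime]
    -- a flat affine group scheme `Z = Spec H` of finite type over `ℤ_p`
    (H : Type v) [CommRing H] [HopfAlgebra ℤ_[p] H]
    [Module.Flat ℤ_[p] H] [Algebra.FiniteType ℤ_[p] H]
    -- a `Z`-torsor `P = Spec B`
    (B : Type v) [CommRing B] [Algebra ℤ_[p] B] (P : Torsor ℤ_[p] H B)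
    -- a `p`-divisible group over a scheme `S`, with an action of `Z`
    (S : Scheme.{u}) (D : PDivGroup p S) (ρ : GroupHom ℤ_[p] H D.EndRing) :
    -- the twist is a `p`-divisible group
    (∃ E : PDivGroup p S, Nonempty (D.TwistRep ρ P E) ∧
      ∀ n, 1 ≤ n → IsTruncatedPDiv p n (E.G.obj n)) ∧
    -- if `S` is integral and flat over `ℤ_(p)`, and `Z` is smooth with connected fibers
    (∀ [IsIntegral S] (f : S ⟶ specZLoc p) [Flat f] [Algebra.Smooth ℤ_[p] H],
      (∀ q : PrimeSpectrum ℤ_[p], ConnectedSpace (PrimeSpectrum (q.asIdeal.Fiber H))) →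
      -- for every geometric generic point of `S`
      ∀ (Ω : Type u) [Field Ω] [IsAlgClosed Ω] [Algebra S.functionField Ω]
        (E : PDivGroup p S) (e : D.TwistRep ρ P E),
        (∃! c, PDivGroup.IsTateComparison e (PDivGroup.genPt S Ω) c) ∧
        ∀ c, PDivGroup.IsTateComparison e (PDivGroup.genPt S Ω) c →
          ∀ t : TensorSpace ℤ_[p] (D.tate (PDivGroup.genPt S Ω)),
            PDivGroup.IsInvariantTensor ρ (PDivGroup.genPt S Ω) t →
            (∃! t', PDivGroup.CorrespondingTensor c t' t) ∧
            ∃ φ : E.G ≅ D.G, ∀ t', PDivGroup.CorrespondingTensor c t' t →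
              TensorSpace.map (PDivGroup.tateEquiv φ (PDivGroup.genPt S Ω)) t' = t) := by
  refine ⟨?_, fun f _ _ hH Ω _ _ _ E e => ?_⟩
  · obtain ⟨E, hE⟩ := D.exists_twistRep ρ P
    exact ⟨E, hE, fun n _ => ⟨E, ⟨Iso.refl _⟩⟩⟩
  -- Connectedness of the fibre over the closed point feeds Lang's theorem, which trivializes the
  -- torsor.
  · have := hH ⟨IsLocalRing.maximalIdeal ℤ_[p], inferInstance⟩
    obtain ⟨y⟩ := P.exists_point (q := IsLocalRing.maximalIdeal ℤ_[p]) (by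
      rw [PadicInt.maximalIdeal_eq_span_p]
      exact Ideal.mem_span_singleton_self _)
    have := D.finite_pts_genPt Ω 1
    have := D.tate_finite (T := PDivGroup.genPt S Ω)
    have := D.tate_isTorsionFree (PDivGroup.genPt S Ω)
    have : Module.Free ℤ_[p] (D.tate (PDivGroup.genPt S Ω)) :=
      Module.free_of_finite_type_torsion_free'
    refine ⟨⟨_, e.isTateComparison_comparison y _, fun c hc => e.eq_comparison y hc⟩,
      fun c hc t ht => ?_⟩
    -- The comparison is now the one through `y`, so `e.iso y` serves as `φ`, and `t'` is the
    -- preimage of `t` under it.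
    obtain rfl := e.eq_comparison y hc
    simp only [e.correspondingTensor_comparison_iff y ht]
    exact ⟨⟨_, TensorSpace.map_map_symm _ t, fun t' h => by
      rw [← h, TensorSpace.map_symm_map]⟩, e.iso y, fun t' h => h⟩
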